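/- Let $\sigma_1=\begin{pmatrix}0&1\\1&0\end{pmatrix}$, $\sigma_2=\begin{pmatrix}0&-i\\i&0\end{pmatrix}$, $\sigma_3=\begin{pmatrix}1&0\\0&-1\end{pmatrix}$ be the Pauli matrices, and for $x=(x_1,x_2)\in\mathbb{S}^1\subset\mathbb{R}^2$ put $\sigma\cdot x=x_1\sigma_1+x_2\sigma_2$. For $\delta\ge 0$ and $x\in\mathbb{S}^1$ consider in $L^2((-1,1),\mathbb{C}^2)$ the operator \[ \mathcal{T}_x(\delta)=-i(\sigma\cdot x)\frac{d}{dt}+\delta\sigma_3,\qquad \mathrm{dom}(\mathcal{T}_x(\delta))=\{f=(f_1,f_2)^\top\in H^1((-1,1),\mathbb{C}^2): f_2(\pm1)=\pm i(x_1+ix_2)f_1(\pm1)\}. \] Then the following holds. (i) For all $\delta\ge0$ and $x\in\mathbb{S}^1$ the operator $\mathcal{T}_x(\delta)$ is self-adjoint with compact resolvent, its spectrum is symmetric with respect to $0$ and does not depend on $x$. It has infinitely many positive eigenvalues; they can be listed in non-decreasing order with multiplicities as $\lambda_1(\delta)\le\lambda_2(\delta)\le\cdots$, the same list for all $x$, and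 for every $j\ge1$ \[ (2j-1)^2\frac{\pi^2}{16}\le\lambda_j(\delta)^2-\delta^2\le j^2\frac{\pi^2}{4}. \] If $\phi$ is a normalized eigenfunction of $\mathcal{T}_x(\delta)$ for $\lambda_j(\delta)$, then $\sigma_1\overline{\phi}$ is a normalized eigenfunction for $-\lambda_j(\delta)$. (ii) For every fixed $j\ge1$, as $\delta\to0$ with $\delta\ge0$, \[ \lambda_j(\delta)=\frac{(2j-1)\pi}{4}+\frac{2}{(2j-1)\pi}\delta+\left(\frac{-16}{(2j-1)^3\pi^3}+\frac{2}{(2j-1)\pi}\right)\delta^2+\mathcal{O}(\delta^3). \] (iii) For $j\ge1$ and $x\in\mathbb{S}^1$ let \[ \phi_j^+(t)=\tfrac12\cos\Big(\tfrac{(2j-1)\pi}{4}(t+1)\Big)\begin{pmatrix}1\\-i(x_1+ix_2)\end{pmatrix}+\tfrac12\sin\Big(\tfrac{(2j-1)\pi}{4}(t+1)\Big)\begin{pmatrix}1\\i(x_1+ix_2)\end{pmatrix},\qquad \phi_j^-=\sigma_1\overline{\phi_j^+}. \] For every $j\ge1$ there are $C,\delta_0>0$ such that for all $\delta\in[0,\delta_0]$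 and $x\in\mathbb{S}^1$ there is a normalized eigenfunction $\phi_{j,\delta}^+$ of $\mathcal{T}_x(\delta)$ for $\lambda_j(\delta)$ such that, with $\phi_{j,\delta}^-=\sigma_1\overline{\phi_{j,\delta}^+}$, \[ \|\phi_{j,\delta}^\pm-\phi_j^\pm\|_{L^\infty((-1,1),\mathbb{C}^2)}\le C\delta ; \] moreover, for every normalized eigenfunction $\psi$ for $\pm\lambda_j(\delta)$ there is $c\in\mathbb{C}$ with $|c|=1$ and $\|c\psi-\phi_j^\pm\|_{L^\infty}\le C\delta$. (iv) For all $\delta\ge0$, $x\in\mathbb{S}^1$ and $f\in\mathrm{dom}(\mathcal{T}_x(\delta))$, \[ \|\mathcal{T}_x(\delta)f\|_{L^2}^2=\|f'\|_{L^2}^2+\delta^2\|f\|_{L^2}^2+\delta\big(|f(1)|^2+|f(-1)|^2\big). \] -/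

import Mathlib

open MeasureTheory
open scoped ContDiff Matrix

namespace TransverseDirac

noncomputable section

/-! ### Unbounded operators: resolvent, spectrum, eigenvalues -/

section Operators

variable {H : Type} [NormedAddCommGroup H] [NormedSpace ℂ H]

/-- `R` is a bounded everywhere defined two-sided inverse of `T - z : dom T → H`. -/
def IsResolvent (T : H →ₗ.[ℂ] H) (z : ℂ) (R : H →L[ℂ] H) : Prop :=
  (∀ y : H, ∃ h : R y ∈ T.domain, T ⟨R y, h⟩ - z • R y = y) ∧
  (∀ f : T.domain, R (T f - z • (f : H)) = f)

/-- The resolvent set of an unbounded operator. -/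
def resolventSet (T : H →ₗ.[ℂ] H) : Set ℂ := {z | ∃ R : H →L[ℂ] H, IsResolvent T z R}

/-- The spectrum of an unbounded operator. -/
def spectrum (T : H →ₗ.[ℂ] H) : Set ℂ := (resolventSet T)ᶜ

/-- The resolvent set is non-empty and all resolvents are compact operators. -/
def HasCompactResolvent (T : H →ₗ.[ℂ] H) : Prop :=
  (resolventSet T).Nonempty ∧
    ∀ (z : ℂ) (R : H →L[ℂ] H), IsResolvent T z R → IsCompactOperator R

/-- The space `{f ∈ dom T : T f = z f}`. -/
def eigenspace (T : H →ₗ.[ℂ] H) (z : ℂ) : Submodule ℂ H where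
  carrier := {f | ∃ h : f ∈ T.domain, T ⟨f, h⟩ = z • f}
  zero_mem' := ⟨T.domain.zero_mem, by
    rw [smul_zero]; exact T.map_zero⟩
  add_mem' := by
    rintro f g ⟨hf, ef⟩ ⟨hg, eg⟩
    refine ⟨T.domain.add_mem hf hg, ?_⟩
    have := T.map_add ⟨f, hf⟩ ⟨g, hg⟩
    rw [ef, eg, ← smul_add] at this
    exact this
  smul_mem' := by
    rintro c f ⟨hf, ef⟩
    refine ⟨T.domain.smul_mem c hf, ?_⟩
    have := T.map_smul c ⟨f, hf⟩
    rw [ef, smul_comm] at this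
    exact this

/-- `f` is a normalized eigenvector of `T` for the eigenvalue `z`. -/
def IsNormalizedEigenvector (T : H →ₗ.[ℂ] H) (z : ℂ) (f : H) : Prop :=
  f ∈ eigenspace T z ∧ ‖f‖ = 1

/-- `lam 1 ≤ lam 2 ≤ ...` is the sequence of all positive eigenvalues of `T` in non-decreasing
order, each one repeated according to its multiplicity; that is, `lam j` is the `j`-th positive
eigenvalue of `T` for every `j ≥ 1` (the value `lam 0` is not used). -/
def IsPosEigenvalueSeq (T : H →ₗ.[ℂ] H) (lam : ℕ → ℝ) : Prop :=
  MonotoneOn lam (Set.Ici 1) ∧ (∀ j, 1 ≤ j → 0 < lam j) ∧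
    ∀ μ : ℝ, 0 < μ →
      Module.rank ℂ (eigenspace T (μ : ℂ)) = Cardinal.mk {j : ℕ // 1 ≤ j ∧ lam j = μ}

end Operators

/-! ### The spaces `L²((-1,1),ℂ²)` and `H¹((-1,1),ℂ²)` -/

/-- `ℂ²` with its Hermitian norm. -/
abbrev C2 := EuclideanSpace ℂ (Fin 2)

/-- Lebesgue measure on `(-1,1)`. -/
abbrev vol : Measure ℝ := volume.restrict (Set.Ioo (-1 : ℝ) 1)

/-- The Hilbert space `L²((-1,1),ℂ²)`. -/
abbrev L2 := Lp C2 2 vol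

/-- `g` is the weak derivative of `f` on `(-1,1)`. -/
def HasWeakDeriv (f g : L2) : Prop :=
  ∀ φ : ℝ → ℝ, ContDiff ℝ ∞ φ → HasCompactSupport φ → tsupport φ ⊆ Set.Ioo (-1 : ℝ) 1 →
    ∫ t, deriv φ t • f t ∂vol = - ∫ t, φ t • g t ∂vol

theorem integrable_smul {φ : ℝ → ℝ} (hφ : Continuous φ) (hs : HasCompactSupport φ) (f : L2) :
    Integrable (fun t => φ t • f t) vol := by
  obtain ⟨C, hC⟩ := hs.exists_bound_of_continuous hφ
  have hf : Integrable (fun t => f t) vol := (Lp.memLp f).integrable (by norm_num)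
  exact hf.bdd_smul C hφ.aestronglyMeasurable (Filter.Eventually.of_forall hC)

theorem integral_smul_add {φ : ℝ → ℝ} (hφ : Continuous φ) (hs : HasCompactSupport φ) (f g : L2) :
    ∫ t, φ t • (f + g : L2) t ∂vol = (∫ t, φ t • f t ∂vol) + ∫ t, φ t • g t ∂vol := by
  rw [← integral_add (integrable_smul hφ hs f) (integrable_smul hφ hs g)]
  refine integral_congr_ae ?_
  filter_upwards [Lp.coeFn_add f g] with t ht
  rw [ht, Pi.add_apply, smul_add]

theorem integral_smul_smul (φ : ℝ → ℝ) (c : ℂ) (f : L2) :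
    ∫ t, φ t • (c • f : L2) t ∂vol = c • ∫ t, φ t • f t ∂vol := by
  rw [← integral_smul]
  refine integral_congr_ae ?_
  filter_upwards [Lp.coeFn_smul c f] with t ht
  rw [ht, Pi.smul_apply, smul_comm]

theorem HasWeakDeriv.add {f g f' g' : L2} (hf : HasWeakDeriv f f') (hg : HasWeakDeriv g g') :
    HasWeakDeriv (f + g) (f' + g') := by
  intro φ h1 h2 h3
  rw [integral_smul_add (h1.continuous_deriv (by simp)) h2.deriv,
    integral_smul_add h1.continuous h2, hf φ h1 h2 h3, hg φ h1 h2 h3, neg_add]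

theorem HasWeakDeriv.smul {f f' : L2} (c : ℂ) (hf : HasWeakDeriv f f') :
    HasWeakDeriv (c • f) (c • f') := by
  intro φ h1 h2 h3
  rw [integral_smul_smul, integral_smul_smul, hf φ h1 h2 h3, smul_neg]

theorem HasWeakDeriv.zero : HasWeakDeriv 0 0 := by
  have h : HasWeakDeriv ((0 : ℂ) • (0 : L2)) ((0 : ℂ) • (0 : L2)) := by
    intro φ _ _ _
    rw [integral_smul_smul, integral_smul_smul, zero_smul, zero_smul, neg_zero]
  simpa using h

theorem HasWeakDeriv.unique {f g g' : L2} (h : HasWeakDeriv f g) (h' : HasWeakDeriv f g') :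
    g = g' := by
  have hd : HasWeakDeriv (f + (-1 : ℂ) • f) (g + (-1 : ℂ) • g') := h.add (h'.smul (-1))
  have hf : f + (-1 : ℂ) • f = 0 := by simp
  rw [hf] at hd
  have hint : Integrable (fun t => (g + (-1 : ℂ) • g' : L2) t) vol :=
    (Lp.memLp _).integrable (by norm_num)
  have key := (isOpen_Ioo (a := (-1 : ℝ)) (b := 1)).ae_eq_zero_of_integral_contDiff_smul_eq_zero
    (μ := vol) (f := fun t => (g + (-1 : ℂ) • g' : L2) t)
    (hint.locallyIntegrable.locallyIntegrableOn _) (by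
      intro φ h1 h2 h3
      have e := hd φ h1 h2 h3
      have z : ∫ t, deriv φ t • (0 : L2) t ∂vol = 0 := by
        have := integral_smul_smul (deriv φ) 0 0
        simpa using this
      rw [z] at e
      exact neg_eq_zero.mp e.symm)
  have hz : g + (-1 : ℂ) • g' = 0 := by
    rw [Lp.eq_zero_iff_ae_eq_zero]
    filter_upwards [key, ae_restrict_mem measurableSet_Ioo] with t ht hmem
    exact ht hmem
  have : g - g' = 0 := by simpa [sub_eq_add_neg] using hz
  exact sub_eq_zero.mp this

/-- The Sobolev space `H¹((-1,1),ℂ²)`, as a subspace of `L²((-1,1),ℂ²)`. -/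
def H1 : Submodule ℂ L2 where
  carrier := {f | ∃ g, HasWeakDeriv f g}
  zero_mem' := ⟨0, HasWeakDeriv.zero⟩
  add_mem' := fun ⟨g, hg⟩ ⟨g', hg'⟩ => ⟨g + g', hg.add hg'⟩
  smul_mem' := fun c _ ⟨g, hg⟩ => ⟨c • g, hg.smul c⟩

/-- The weak derivative `f ↦ f'` on `H¹((-1,1),ℂ²)`. -/
def weakDeriv : H1 →ₗ[ℂ] L2 where
  toFun f := Classical.choose f.2
  map_add' f g := (Classical.choose_spec (f + g).2).unique
    ((Classical.choose_spec f.2).add (Classical.choose_spec g.2))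
  map_smul' c f := (Classical.choose_spec (c • f).2).unique
    ((Classical.choose_spec f.2).smul c)

theorem hasWeakDeriv_weakDeriv (f : H1) : HasWeakDeriv f (weakDeriv f) :=
  Classical.choose_spec f.2

/-- `u` is a representative of `f` that is continuous on `[-1,1]`. Every element of
`H¹((-1,1),ℂ²)` has one, unique on `[-1,1]`; its values at `±1` are the boundary values `f(±1)`. -/
def IsContRep (f : L2) (u : ℝ → C2) : Prop :=
  ContinuousOn u (Set.Icc (-1) 1) ∧ f =ᵐ[vol] u

/-! ### The transverse operator -/

/-- The Pauli matrix `σ₁`. -/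
def pauli1 : Matrix (Fin 2) (Fin 2) ℂ := !![0, 1; 1, 0]

/-- The Pauli matrix `σ₂`. -/
def pauli2 : Matrix (Fin 2) (Fin 2) ℂ := !![0, -Complex.I; Complex.I, 0]

/-- The Pauli matrix `σ₃`. -/
def pauli3 : Matrix (Fin 2) (Fin 2) ℂ := !![1, 0; 0, -1]

/-- `σ · x = x₁ σ₁ + x₂ σ₂`. -/
def pauliDot (x : EuclideanSpace ℝ (Fin 2)) : Matrix (Fin 2) (Fin 2) ℂ :=
  (x 0 : ℂ) • pauli1 + (x 1 : ℂ) • pauli2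

/-- The complex number `x₁ + i x₂`. -/
def toC (x : EuclideanSpace ℝ (Fin 2)) : ℂ := (x 0 : ℂ) + Complex.I * (x 1 : ℂ)

/-- Pointwise multiplication by a constant matrix, on `L²((-1,1),ℂ²)`. -/
def matMul (A : Matrix (Fin 2) (Fin 2) ℂ) : L2 →L[ℂ] L2 :=
  (Matrix.toEuclideanCLM (𝕜 := ℂ) A).compLpL 2 vol

/-- The boundary conditions `u₂(±1) = ± i (x₁ + i x₂) u₁(±1)`. -/
def BoundaryCond (x : EuclideanSpace ℝ (Fin 2)) (u : ℝ → C2) : Prop :=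
  u 1 1 = Complex.I * toC x * u 1 0 ∧ u (-1) 1 = -(Complex.I * toC x * u (-1) 0)

/-- The domain of the transverse operator: the elements of `H¹((-1,1),ℂ²)` whose boundary values
satisfy the boundary conditions. -/
def transverseDomain (x : EuclideanSpace ℝ (Fin 2)) : Submodule ℂ L2 where
  carrier := {f | f ∈ H1 ∧ ∃ u, IsContRep f u ∧ BoundaryCond x u}
  zero_mem' := ⟨H1.zero_mem, 0, ⟨continuousOn_const, Lp.coeFn_zero _ _ _⟩, by
    simp [BoundaryCond]⟩
  add_mem' := by
    rintro f g ⟨hf, u, ⟨cu, eu⟩, bu⟩ ⟨hg, v, ⟨cv, ev⟩, bv⟩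
    refine ⟨H1.add_mem hf hg, u + v, ⟨cu.add cv, ?_⟩, ?_, ?_⟩
    · exact (Lp.coeFn_add f g).trans (eu.add ev)
    · simp only [Pi.add_apply, PiLp.add_apply, bu.1, bv.1]; ring
    · simp only [Pi.add_apply, PiLp.add_apply, bu.2, bv.2]; ring
  smul_mem' := by
    rintro c f ⟨hf, u, ⟨cu, eu⟩, bu⟩
    refine ⟨H1.smul_mem c hf, c • u, ⟨cu.const_smul c, ?_⟩, ?_, ?_⟩
    · exact (Lp.coeFn_smul c f).trans (eu.const_smul c)
    · simp only [Pi.smul_apply, PiLp.smul_apply, smul_eq_mul, bu.1]; ring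
    · simp only [Pi.smul_apply, PiLp.smul_apply, smul_eq_mul, bu.2]; ring

theorem transverseDomain_le (x : EuclideanSpace ℝ (Fin 2)) : transverseDomain x ≤ H1 :=
  fun _ h => h.1

/-- The weak derivative of an element of the domain of the transverse operator. -/
def domDeriv (x : EuclideanSpace ℝ (Fin 2)) : transverseDomain x →ₗ[ℂ] L2 :=
  weakDeriv ∘ₗ Submodule.inclusion (transverseDomain_le x)

/-- The transverse operator `f ↦ -i (σ · x) f' + δ σ₃ f`. -/
def transverseOp (x : EuclideanSpace ℝ (Fin 2)) (δ : ℝ) : L2 →ₗ.[ℂ] L2 where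
  domain := transverseDomain x
  toFun := (-Complex.I) • ((matMul (pauliDot x)).toLinearMap ∘ₗ domDeriv x) +
    (δ : ℂ) • ((matMul pauli3).toLinearMap ∘ₗ (transverseDomain x).subtype)

/-! ### Charge conjugation and the limit profiles -/

/-- Componentwise complex conjugation on `ℂ²`. -/
def conjC2 : C2 →SL[starRingEnd ℂ] C2 where
  toFun v := WithLp.toLp 2 (fun i => starRingEnd ℂ (v i))
  map_add' v w := by ext i; simp
  map_smul' c v := by ext i; simp
  cont := by fun_prop

/-- The charge conjugation `v ↦ σ₁ v̄` on `ℂ²`. -/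
def chargeConjC2 : C2 →SL[starRingEnd ℂ] C2 :=
  (Matrix.toEuclideanCLM (𝕜 := ℂ) pauli1).comp conjC2

/-- The charge conjugation `f ↦ σ₁ f̄` on `L²((-1,1),ℂ²)`. -/
def chargeConj : L2 →SL[starRingEnd ℂ] L2 := chargeConjC2.compLpL 2 vol

/-- The profile `φ_j⁺`. -/
def profilePlus (x : EuclideanSpace ℝ (Fin 2)) (j : ℕ) (t : ℝ) : C2 :=
  ((1 / 2 * Real.cos ((2 * j - 1) * Real.pi / 4 * (t + 1)) : ℝ) : ℂ) •
      !₂[(1 : ℂ), -(Complex.I * toC x)] +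
    ((1 / 2 * Real.sin ((2 * j - 1) * Real.pi / 4 * (t + 1)) : ℝ) : ℂ) •
      !₂[(1 : ℂ), Complex.I * toC x]

/-- The profile `φ_j⁻ = σ₁ conj(φ_j⁺)`. -/
def profileMinus (x : EuclideanSpace ℝ (Fin 2)) (j : ℕ) (t : ℝ) : C2 :=
  chargeConjC2 (profilePlus x j t)

/-- The distance in `L^∞((-1,1),ℂ²)`. -/
def supDist (f g : ℝ → C2) : ENNReal := eLpNorm (fun t => f t - g t) ⊤ vol

end

end TransverseDirac

/-! Everything is governed by the Hermitian involution B = i(σ·x)σ₃ (`swapMat`). It anticommutes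
with σ·x and with σ₃, and the boundary conditions say precisely that Bf = ±f at ±1.

Expanding ‖T f‖² leaves the cross term 2δ Re⟨f', Bf⟩, which integrates by parts to δ(|f(1)|² +
|f(-1)|²). This is (iv), `norm_sq_transverseOp`. It makes T injective for δ ≥ 0. For δ = 0 the
operator is inverted explicitly by a Volterra operator plus a finite-rank correction, which is
compact; the Fredholm alternative then inverts T for every δ ≥ 0 (`exists_isResolvent_zero`). A
symmetric operator with a bounded everywhere defined inverse is self-adjoint. Conjugation by B turns
T into -T, so the spectrum is symmetric, and a constant diagonal unitary matrix relates different x.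

Multiplying T f = μf by i(σ·x) gives a linear system f' = Mf with constant M. In the basis v₋, v₊ of
eigenvectors of B the matrix M is real with M² = -(μ² - δ²), and (iv) shows that k² = μ² - δ² is
positive for an eigenvalue μ. The condition at -1 fixes the initial direction v₋, hence every
eigenvalue is simple (`exists_smul_eigenVec`). The condition at 1 becomes cos 2k + (δ/k) sin 2k = 0,
equivalently cos(2k - arctan(δ/k)) = 0. The phase 2k - arctan(δ/k) is strictly increasing, so it
takes the value (2j-1)π/2 at exactly one k = k_j > 0 (`secular_iff`). As the arctangent lies in [0,
π/2), the bounds in (i) follow, and λ_j = √(k_j² + δ²).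

For (ii), k_j - c = ½ arctan(δ/k_j) with c = (2j-1)π/4 is iterated to second order. For (iii), the
explicit solutions depend on δ in a Lipschitz way, uniformly in t, and reduce to twice the profile
at δ = 0. Charge conjugation commutes with B and changes μ into -μ, which carries these statements
to the negative eigenvalues. -/

namespace TransverseDirac

noncomputable section

/-! ### Primitives of integrable functions on `(-1,1)` -/

section Primitive

variable {E F G : Type*} [NormedAddCommGroup E] [NormedSpace ℝ E]
  [NormedAddCommGroup F] [NormedSpace ℝ F] [NormedAddCommGroup G] [NormedSpace ℝ G]

/-- The primitive vanishing at `-1` of a function on `(-1,1)`. -/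
def prim (f : ℝ → E) (t : ℝ) : E := ∫ s in Set.Iic t, f s ∂vol

theorem prim_neg_one (f : ℝ → E) : prim f (-1) = 0 := by
  have : vol.restrict (Set.Iic (-1 : ℝ)) = 0 := by
    rw [Measure.restrict_restrict measurableSet_Iic]
    have : Set.Iic (-1 : ℝ) ∩ Set.Ioo (-1) 1 = ∅ := by
      ext t; simp only [Set.mem_inter_iff, Set.mem_Iic, Set.mem_Ioo, Set.mem_empty_iff_false]
      constructor
      · rintro ⟨h, h', _⟩; linarith
      · exact False.elim
    rw [this, Measure.restrict_empty]
  rw [prim, this, integral_zero_measure]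

theorem prim_one (f : ℝ → E) : prim f 1 = ∫ s, f s ∂vol := by
  rw [prim, Measure.restrict_restrict measurableSet_Iic]
  congr 2
  exact Set.inter_eq_right.mpr fun t ht => ht.2.le

theorem prim_congr {f g : ℝ → E} (h : f =ᵐ[vol] g) : prim f = prim g := by
  funext t
  exact integral_congr_ae (ae_restrict_of_ae h)

theorem prim_eq_intervalIntegral (f : ℝ → E) {t : ℝ} (ht : t ∈ Set.Icc (-1 : ℝ) 1) :
    prim f t = ∫ s in (-1)..t, f s := by
  rw [prim, Measure.restrict_restrict measurableSet_Iic,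
    intervalIntegral.integral_of_le ht.1]
  rcases eq_or_lt_of_le ht.2 with h | h
  · subst h
    rw [Set.inter_eq_right.mpr fun t ht => ht.2.le, integral_Ioc_eq_integral_Ioo]
  · congr 2
    ext s
    simp only [Set.mem_inter_iff, Set.mem_Iic, Set.mem_Ioo, Set.mem_Ioc]
    constructor
    · rintro ⟨h1, h2, h3⟩; exact ⟨h2, h1⟩
    · rintro ⟨h1, h2⟩; exact ⟨h2, h1, h2.trans_lt h⟩

theorem prim_sub_prim {f : ℝ → E} (hf : Integrable f vol) {s t : ℝ} (h : s ≤ t) :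
    prim f t - prim f s = ∫ r in Set.Ioc s t, f r ∂vol := by
  rw [prim, prim, ← Set.Iic_union_Ioc_eq_Iic h, setIntegral_union
    (Set.Iic_disjoint_Ioc le_rfl) measurableSet_Ioc hf.integrableOn hf.integrableOn]
  abel

theorem continuous_prim {f : ℝ → E} (hf : Integrable f vol) : Continuous (prim f) := by
  have h : prim f = fun t => (∫ s in Set.Iic (0 : ℝ), f s ∂vol) + ∫ s in (0 : ℝ)..t, f s ∂vol := by
    funext t
    rw [← intervalIntegral.integral_Iic_sub_Iic hf.integrableOn hf.integrableOn]
    simp [prim]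
  rw [h]
  exact continuous_const.add
    (intervalIntegral.continuous_primitive (fun a b => hf.intervalIntegrable) 0)

/-- Integration by parts for a bilinear product of two primitives. -/
theorem integral_bilin_prim [CompleteSpace E] [CompleteSpace F] [CompleteSpace G]
    (L : E →L[ℝ] F →L[ℝ] G) {f : ℝ → E} {g : ℝ → F}
    (hf : Integrable f vol) (hg : Integrable g vol) :
    (∫ t, L (prim f t) (g t) ∂vol) + ∫ t, L (f t) (prim g t) ∂vol =
      L (∫ t, f t ∂vol) (∫ t, g t ∂vol) := by
  have hI : Integrable (fun p : ℝ × ℝ => L (f p.1) (g p.2)) (vol.prod vol) :=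
    Integrable.op_fst_snd (op := fun a b => L a b) (by fun_prop)
      ⟨‖L‖, fun a b => L.le_opNorm₂ a b⟩ hf hg
  -- Both integrals become double integrals of the product over parts of the square: s ≤ t for the
  -- first, and the strict complement for the second, where dropping the diagonal point of the inner
  -- integral costs nothing because the measure has no atoms. Together the two parts fill the
  -- square.
  set D : Set (ℝ × ℝ) := {p | p.1 ≤ p.2} with hD
  have hDm : MeasurableSet D := measurableSet_le measurable_fst measurable_snd
  have e1 : ∫ t, L (prim f t) (g t) ∂vol = ∫ p in D, L (f p.1) (g p.2) ∂(vol.prod vol) := by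
    rw [← integral_indicator hDm, integral_prod_symm _ (hI.indicator hDm)]
    refine integral_congr_ae (Filter.Eventually.of_forall fun t => ?_)
    have : (fun s : ℝ => D.indicator (fun p : ℝ × ℝ => L (f p.1) (g p.2)) (s, t)) =
        (Set.Iic t).indicator (fun s => L.flip (g t) (f s)) := by
      funext s
      by_cases h : s ≤ t
      · rw [Set.indicator_of_mem (show (s, t) ∈ D from h), Set.indicator_of_mem (Set.mem_Iic.2 h)]
        rfl
      · rw [Set.indicator_of_notMem (show (s, t) ∉ D from h),
          Set.indicator_of_notMem (fun h' => h (Set.mem_Iic.1 h'))]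
    dsimp only
    rw [this, integral_indicator measurableSet_Iic,
      ContinuousLinearMap.integral_comp_comm _ hf.integrableOn]
    rfl
  have e2 : ∫ t, L (f t) (prim g t) ∂vol = ∫ p in Dᶜ, L (f p.1) (g p.2) ∂(vol.prod vol) := by
    rw [← integral_indicator hDm.compl, integral_prod _ (hI.indicator hDm.compl)]
    refine integral_congr_ae (Filter.Eventually.of_forall fun t => ?_)
    have : (fun s : ℝ => Dᶜ.indicator (fun p : ℝ × ℝ => L (f p.1) (g p.2)) (t, s)) =
        (Set.Iio t).indicator (fun s => L (f t) (g s)) := by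
      funext s
      by_cases h : s < t
      · rw [Set.indicator_of_mem (show (t, s) ∈ Dᶜ from not_le.2 h),
          Set.indicator_of_mem (Set.mem_Iio.2 h)]
      · rw [Set.indicator_of_notMem (show (t, s) ∉ Dᶜ from fun h' => h (not_le.1 h')),
          Set.indicator_of_notMem (fun h' => h (Set.mem_Iio.1 h'))]
    dsimp only
    rw [this, integral_indicator measurableSet_Iio,
      ContinuousLinearMap.integral_comp_comm _ hg.integrableOn, prim, integral_Iic_eq_integral_Iio]
  rw [e1, e2, integral_add_compl hDm hI, integral_prod _ hI]
  have : ∀ t, ∫ s, L (f t) (g s) ∂vol = L.flip (∫ s, g s ∂vol) (f t) := fun t => by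
    rw [ContinuousLinearMap.integral_comp_comm _ hg]; rfl
  simp only [this]
  rw [ContinuousLinearMap.integral_comp_comm _ hf]
  rfl

theorem prim_eq_sub_of_hasDerivAt [CompleteSpace E] {u u' : ℝ → E}
    (h : ∀ t, HasDerivAt u (u' t) t) (hc : Continuous u') {t : ℝ} (ht : t ∈ Set.Icc (-1 : ℝ) 1) :
    prim u' t = u t - u (-1) := by
  rw [prim_eq_intervalIntegral _ ht]
  exact intervalIntegral.integral_eq_sub_of_hasDerivAt (fun s _ => h s) (hc.intervalIntegrable _ _)

end Primitive

/-! ### Weak derivatives -/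

theorem integrable_coe (f : L2) : Integrable (fun t => f t) vol :=
  (Lp.memLp f).integrable (by norm_num)

theorem eq_zero_of_notMem_Ioo {φ : ℝ → ℝ} (h3 : tsupport φ ⊆ Set.Ioo (-1 : ℝ) 1) {t : ℝ}
    (ht : t ∉ Set.Ioo (-1 : ℝ) 1) : φ t = 0 :=
  image_eq_zero_of_notMem_tsupport fun h => ht (h3 h)

/-- A test function is the primitive of its derivative and vanishes at both endpoints, so
integration by parts for primitives leaves no boundary term and kills the constant. -/
theorem hasWeakDeriv_of_ae_eq {f g : L2} {c : C2} (h : f =ᵐ[vol] fun t => c + prim g t) :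
    HasWeakDeriv f g := by
  intro φ h1 h2 h3
  have hd : Continuous (deriv φ) := h1.continuous_deriv (by simp)
  have hφ : ∀ t, HasDerivAt φ (deriv φ t) t := fun t =>
    (h1.differentiable (by simp) t).hasDerivAt
  have hm : φ (-1) = 0 := eq_zero_of_notMem_Ioo h3 (by simp)
  have hp : φ 1 = 0 := eq_zero_of_notMem_Ioo h3 (by simp)
  have hprim : ∀ t ∈ Set.Icc (-1 : ℝ) 1, prim (deriv φ) t = φ t := fun t ht => by
    rw [prim_eq_sub_of_hasDerivAt hφ hd ht, hm, sub_zero]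
  have hint : Integrable (deriv φ) vol := by
    have : Integrable (deriv φ) volume := hd.integrable_of_hasCompactSupport h2.deriv
    exact this.restrict
  have key := integral_bilin_prim (ContinuousLinearMap.lsmul ℝ ℝ (E := C2)) hint (integrable_coe g)
  have z : ∫ t, deriv φ t ∂vol = 0 := by
    rw [← prim_one, hprim 1 (by simp), hp]
  simp only [ContinuousLinearMap.lsmul_apply] at key
  rw [z, zero_smul] at key
  have a1 : ∫ t, prim (deriv φ) t • g t ∂vol = ∫ t, φ t • g t ∂vol := by
    refine setIntegral_congr_fun measurableSet_Ioo fun t ht => ?_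
    rw [hprim t ⟨ht.1.le, ht.2.le⟩]
  have a2 : ∫ t, deriv φ t • f t ∂vol =
      (∫ t, deriv φ t • c ∂vol) + ∫ t, deriv φ t • prim g t ∂vol := by
    rw [← integral_add]
    · refine integral_congr_ae ?_
      filter_upwards [h] with t ht
      rw [ht, smul_add]
    · exact hint.smul_const c
    · obtain ⟨C, hC⟩ := h2.deriv.exists_bound_of_continuous hd
      have : Integrable (prim g) vol := by
        have : Integrable (fun t => f t - c) vol := (integrable_coe f).sub (integrable_const c)
        refine this.congr ?_
        filter_upwards [h] with t ht
        rw [ht]; abel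
      exact this.bdd_smul C hd.aestronglyMeasurable (Filter.Eventually.of_forall hC)
  rw [a2, integral_smul_const, z, zero_smul, zero_add, ← a1]
  exact eq_neg_of_add_eq_zero_right key

/-- The du Bois-Reymond lemma. -/
theorem ae_const_of_hasWeakDeriv_zero {f : L2} (h : HasWeakDeriv f 0) :
    ∃ c : C2, f =ᵐ[vol] fun _ => c := by
  let b : ContDiffBump (0 : ℝ) := ⟨1 / 4, 1 / 2, by norm_num, by norm_num⟩
  set η : ℝ → ℝ := b.normed volume with hη
  have η1 : ContDiff ℝ ∞ η := b.contDiff_normed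
  have η2 : HasCompactSupport η := b.hasCompactSupport_normed
  have hball : Metric.ball (0 : ℝ) 1 = Set.Ioo (-1) 1 := by
    rw [Real.ball_eq_Ioo]; norm_num
  have η3 : tsupport η ⊆ Set.Ioo (-1 : ℝ) 1 := by
    rw [hη, b.tsupport_normed_eq, ← hball]
    exact Metric.closedBall_subset_ball (by show (1 / 2 : ℝ) < 1; norm_num)
  have ηI : ∫ t, η t = 1 := b.integral_normed
  have toVol : ∀ φ : ℝ → ℝ, tsupport φ ⊆ Set.Ioo (-1 : ℝ) 1 → ∫ t, φ t ∂vol = ∫ t, φ t :=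
    fun φ h3 => setIntegral_eq_integral_of_forall_compl_eq_zero
      fun t ht => eq_zero_of_notMem_Ioo h3 ht
  refine ⟨∫ t, η t • f t ∂vol, ?_⟩
  set c : C2 := ∫ t, η t • f t ∂vol with hc
  have hint : Integrable (fun t => f t - c) vol := (integrable_coe f).sub (integrable_const c)
  have key := (isOpen_Ioo (a := (-1 : ℝ)) (b := 1)).ae_eq_zero_of_integral_contDiff_smul_eq_zero
    (μ := vol) (f := fun t => f t - c) (hint.locallyIntegrable.locallyIntegrableOn _) ?_
  · filter_upwards [key, ae_restrict_mem measurableSet_Ioo] with t ht hmem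
    exact sub_eq_zero.mp (ht hmem)
  intro φ h1 h2 h3
  set I : ℝ := ∫ t, φ t with hI
  -- Removing the mean of φ by a multiple of the unit-mass bump η makes the primitive Θ of θ a test
  -- function. The hypothesis applied to Θ gives ∫ θ f = 0, which is ∫ φ (f - c) = 0.
  set θ : ℝ → ℝ := fun t => φ t - I * η t with hθ
  have θ1 : ContDiff ℝ ∞ θ := h1.sub (contDiff_const.mul η1)
  set Θ : ℝ → ℝ := fun t => ∫ s in (-1)..t, θ s with hΘ
  have dΘ : deriv Θ = θ := funext fun t => Continuous.deriv_integral _ θ1.continuous _ _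
  have Θ1 : ContDiff ℝ ∞ Θ := by
    refine contDiff_infty_iff_deriv.2 ⟨fun t => ?_, by rw [dΘ]; exact θ1⟩
    exact (intervalIntegral.integral_hasDerivAt_right (θ1.continuous.intervalIntegrable _ _)
      θ1.continuous.stronglyMeasurable.stronglyMeasurableAtFilter
      θ1.continuous.continuousAt).differentiableAt
  -- A radius r < 1 that still contains both supports is needed so that Θ, which vanishes for |t| ≥
  -- r, has its closed support inside the open interval.
  obtain ⟨r, hr1, hr⟩ := exists_lt_subset_ball (x := (0 : ℝ)) (r := 1)
    ((isClosed_tsupport φ).union (isClosed_tsupport η))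
    (by rw [hball]; exact Set.union_subset h3 η3)
  have θ0 : ∀ t, r ≤ |t| → θ t = 0 := fun t ht => by
    have hn : t ∉ tsupport φ ∪ tsupport η := fun h' => by
      have := hr h'
      rw [Metric.mem_ball, dist_zero_right, Real.norm_eq_abs] at this
      linarith
    rw [Set.mem_union, not_or] at hn
    simp only [hθ, image_eq_zero_of_notMem_tsupport hn.1, image_eq_zero_of_notMem_tsupport hn.2]
    ring
  have hr0 : 0 < r := by
    have : (0 : ℝ) ∈ tsupport η := by
      rw [hη, b.tsupport_normed_eq]
      exact Metric.mem_closedBall_self b.rOut_pos.le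
    have := hr (Or.inr this)
    rwa [Metric.mem_ball, dist_self] at this
  have hηi : Integrable η := η1.continuous.integrable_of_hasCompactSupport η2
  have hφi : Integrable φ := h1.continuous.integrable_of_hasCompactSupport h2
  have θI : ∫ t, θ t = 0 := by
    simp only [hθ]
    rw [integral_sub hφi (hηi.const_mul I), integral_const_mul, ηI, mul_one, sub_self]
  have ΘL : ∀ t, t ≤ -r → Θ t = 0 := fun t ht => by
    rw [hΘ]
    refine intervalIntegral.integral_zero_ae (Filter.Eventually.of_forall fun s hs => θ0 s ?_)
    have : s ≤ -r := by
      rw [Set.mem_uIoc] at hs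
      rcases hs with hs | hs <;> linarith [hs.1, hs.2]
    rw [abs_of_nonpos (by linarith)]; linarith
  have ΘR : ∀ t, r ≤ t → Θ t = 0 := fun t ht => by
    have : Θ t = ∫ s, θ s := by
      rw [hΘ]
      refine intervalIntegral.integral_eq_integral_of_support_subset fun s hs => ?_
      by_contra hs'
      refine hs (θ0 s ?_)
      rw [Set.mem_Ioc, not_and_or, not_lt, not_le] at hs'
      rcases hs' with hs' | hs'
      · rw [abs_of_nonpos (by linarith)]; linarith
      · rw [abs_of_nonneg (by linarith)]; linarith
    rw [this, θI]
  have Θs : tsupport Θ ⊆ Metric.closedBall 0 r := by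
    refine closure_minimal (fun t ht => ?_) Metric.isClosed_closedBall
    rw [Metric.mem_closedBall, dist_zero_right, Real.norm_eq_abs]
    by_contra hn
    rcases le_total 0 t with h0 | h0
    · rw [abs_of_nonneg h0] at hn; exact ht (ΘR t (by linarith))
    · rw [abs_of_nonpos h0] at hn; exact ht (ΘL t (by linarith))
  have Θ2 : HasCompactSupport Θ :=
    (isCompact_closedBall (0 : ℝ) r).of_isClosed_subset (isClosed_tsupport _) Θs
  have Θ3 : tsupport Θ ⊆ Set.Ioo (-1 : ℝ) 1 := by
    rw [← hball]; exact Θs.trans (Metric.closedBall_subset_ball hr1)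
  have e := h Θ Θ1 Θ2 Θ3
  have z : ∫ t, Θ t • (0 : L2) t ∂vol = 0 := by
    have := integral_smul_smul Θ 0 0
    simpa using this
  rw [z, neg_zero, dΘ] at e
  have i1 := integrable_smul h1.continuous h2 f
  have i2 := integrable_smul η1.continuous η2 f
  have e' : ∫ t, θ t • f t ∂vol = (∫ t, φ t • f t ∂vol) - I • c := by
    have : ∀ t, θ t • f t = φ t • f t - I • (η t • f t) := fun t => by
      simp only [hθ, sub_smul, mul_smul]
    simp only [this]
    rw [integral_sub i1 (i2.fun_smul I), integral_smul]
  simp only [smul_sub]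
  rw [integral_sub i1 (hφi.restrict.smul_const c), integral_smul_const, toVol φ h3, ← hI, ← e', e]

theorem isContRep_of_ae_eq {f g : L2} {c : C2} (h : f =ᵐ[vol] fun t => c + prim g t) :
    IsContRep f (fun t => c + prim g t) :=
  ⟨(continuous_const.add (continuous_prim (integrable_coe g))).continuousOn, h⟩

theorem memLp_of_continuous {E : Type*} [NormedAddCommGroup E] {u : ℝ → E} (hu : Continuous u)
    (p : ENNReal) : MemLp u p vol := by
  obtain ⟨C, hC⟩ := isCompact_Icc.exists_bound_of_continuousOn (s := Set.Icc (-1 : ℝ) 1)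
    hu.continuousOn
  refine MemLp.of_bound hu.aestronglyMeasurable C ?_
  filter_upwards [ae_restrict_mem measurableSet_Ioo] with t ht
  exact hC t ⟨ht.1.le, ht.2.le⟩

/-- The primitive of g also has weak derivative g, and the difference is constant by du
Bois-Reymond. -/
theorem HasWeakDeriv.exists_ae_eq {f g : L2} (h : HasWeakDeriv f g) :
    ∃ c : C2, f =ᵐ[vol] fun t => c + prim g t := by
  have hm : MemLp (prim g) 2 vol := memLp_of_continuous (continuous_prim (integrable_coe g)) 2
  have hp : HasWeakDeriv (hm.toLp _) g := hasWeakDeriv_of_ae_eq (c := 0) (by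
    filter_upwards [hm.coeFn_toLp] with t ht
    rw [ht, zero_add])
  have hz : HasWeakDeriv (f + (-1 : ℂ) • hm.toLp _) 0 := by
    simpa using h.add (hp.smul (-1))
  obtain ⟨c, hc⟩ := ae_const_of_hasWeakDeriv_zero hz
  refine ⟨c, ?_⟩
  filter_upwards [hc, hm.coeFn_toLp, Lp.coeFn_add f ((-1 : ℂ) • hm.toLp _),
    Lp.coeFn_smul (-1 : ℂ) (hm.toLp _)] with t h1 h2 h3 h4
  rw [h3, Pi.add_apply, h4, Pi.smul_apply, h2] at h1
  rw [← h1]; simp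

/-- Almost everywhere equality extends to the closed interval by continuity; this makes the boundary
values independent of the representative. -/
theorem IsContRep.eqOn {f : L2} {u v : ℝ → C2} (hu : IsContRep f u) (hv : IsContRep f v) :
    Set.EqOn u v (Set.Icc (-1) 1) := by
  refine Measure.eqOn_Icc_of_ae_eq volume (by norm_num) ?_ hu.1 hv.1
  rw [← restrict_Ioo_eq_restrict_Icc]
  exact hu.2.symm.trans hv.2

/-- The fundamental theorem of calculus for the continuous representative of an element of `H¹`. -/
theorem HasWeakDeriv.eq_add_prim {f g : L2} (h : HasWeakDeriv f g) {u : ℝ → C2}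
    (hu : IsContRep f u) {t : ℝ} (ht : t ∈ Set.Icc (-1 : ℝ) 1) : u t = u (-1) + prim g t := by
  obtain ⟨c, hc⟩ := h.exists_ae_eq
  have e := hu.eqOn (isContRep_of_ae_eq hc)
  rw [e ht, e (by simp : (-1 : ℝ) ∈ Set.Icc (-1 : ℝ) 1)]
  simp [prim_neg_one]

theorem HasWeakDeriv.exists_isContRep {f g : L2} (h : HasWeakDeriv f g) :
    ∃ u, IsContRep f u := by
  obtain ⟨c, hc⟩ := h.exists_ae_eq
  exact ⟨_, isContRep_of_ae_eq hc⟩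

/-- Integration by parts in `H¹((-1,1),ℂ²)`. -/
theorem HasWeakDeriv.inner_add_inner {f f' g g' : L2} (hf : HasWeakDeriv f f')
    (hg : HasWeakDeriv g g') {u v : ℝ → C2} (hu : IsContRep f u) (hv : IsContRep g v) :
    inner ℂ f' g + inner ℂ f g' = inner ℂ (u 1) (v 1) - inner ℂ (u (-1)) (v (-1)) := by
  -- The inner product is conjugate linear in its first argument, so it is bilinear only over the
  -- reals.
  let L : C2 →L[ℝ] C2 →L[ℝ] ℂ :=
    (isBoundedBilinearMap_inner (𝕜 := ℂ) (E := C2)).toContinuousLinearMap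
  have hL : ∀ a b, L a b = inner ℂ a b := fun _ _ => rfl
  have i1 := integrable_coe f'
  have i2 := integrable_coe g'
  have key := integral_bilin_prim L i1 i2
  have c1 := continuous_prim i1
  have c2 := continuous_prim i2
  obtain ⟨C1, hC1⟩ := isCompact_Icc.exists_bound_of_continuousOn (s := Set.Icc (-1 : ℝ) 1)
    c1.continuousOn
  obtain ⟨C2, hC2⟩ := isCompact_Icc.exists_bound_of_continuousOn (s := Set.Icc (-1 : ℝ) 1)
    c2.continuousOn
  have eu := fun t ht => hf.eq_add_prim hu (t := t) ht
  have ev := fun t ht => hg.eq_add_prim hv (t := t) ht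
  have I1 : Integrable (fun t => L (f' t) (prim g' t)) vol := by
    refine Integrable.mono' (i1.norm.const_mul (‖L‖ * C2))
      (L.aestronglyMeasurable_comp₂ i1.1 c2.aestronglyMeasurable) ?_
    filter_upwards [ae_restrict_mem measurableSet_Ioo] with t ht
    calc _ ≤ ‖L‖ * ‖f' t‖ * ‖prim g' t‖ := L.le_opNorm₂ _ _
      _ ≤ ‖L‖ * ‖f' t‖ * C2 := by gcongr; exact hC2 t ⟨ht.1.le, ht.2.le⟩
      _ = _ := by ring
  have I2 : Integrable (fun t => L (prim f' t) (g' t)) vol := by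
    refine Integrable.mono' (i2.norm.const_mul (‖L‖ * C1))
      (L.aestronglyMeasurable_comp₂ c1.aestronglyMeasurable i2.1) ?_
    filter_upwards [ae_restrict_mem measurableSet_Ioo] with t ht
    calc _ ≤ ‖L‖ * ‖prim f' t‖ * ‖g' t‖ := L.le_opNorm₂ _ _
      _ ≤ ‖L‖ * C1 * ‖g' t‖ := by gcongr; exact hC1 t ⟨ht.1.le, ht.2.le⟩
      _ = _ := by ring
  have a1 : inner ℂ f' g = L (∫ t, f' t ∂vol) (v (-1)) + ∫ t, L (f' t) (prim g' t) ∂vol := by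
    rw [L2.inner_def, ← L.flip_apply, ← ContinuousLinearMap.integral_comp_comm _ i1,
      ← integral_add (ContinuousLinearMap.integrable_comp _ i1) I1]
    refine integral_congr_ae ?_
    filter_upwards [ae_restrict_mem measurableSet_Ioo, hv.2] with t ht e
    rw [e, ev t ⟨ht.1.le, ht.2.le⟩, L.flip_apply, ← map_add, hL]
  have a2 : inner ℂ f g' = L (u (-1)) (∫ t, g' t ∂vol) + ∫ t, L (prim f' t) (g' t) ∂vol := by
    rw [L2.inner_def, ← ContinuousLinearMap.integral_comp_comm _ i2,
      ← integral_add (ContinuousLinearMap.integrable_comp _ i2) I2]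
    refine integral_congr_ae ?_
    filter_upwards [ae_restrict_mem measurableSet_Ioo, hu.2] with t ht e
    rw [e, eu t ⟨ht.1.le, ht.2.le⟩, ← add_apply, ← map_add, hL]
  have hu1 : u 1 = u (-1) + ∫ t, f' t ∂vol := by rw [← prim_one]; exact eu 1 (by simp)
  have hv1 : v 1 = v (-1) + ∫ t, g' t ∂vol := by rw [← prim_one]; exact ev 1 (by simp)
  rw [a1, a2, hu1, hv1, ← hL, ← hL]
  simp only [map_add, add_apply]
  linear_combination key

/-! ### Multiplication by constant matrices -/

/-- The action of a matrix on `ℂ²`. -/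
abbrev matC (A : Matrix (Fin 2) (Fin 2) ℂ) : C2 →L[ℂ] C2 := Matrix.toEuclideanCLM (𝕜 := ℂ) A

theorem matC_apply_zero (A : Matrix (Fin 2) (Fin 2) ℂ) (v : C2) :
    matC A v 0 = A 0 0 * v 0 + A 0 1 * v 1 := by
  simp [matC, Matrix.ofLp_toEuclideanCLM, Matrix.mulVec, dotProduct, Fin.sum_univ_two]

theorem matC_apply_one (A : Matrix (Fin 2) (Fin 2) ℂ) (v : C2) :
    matC A v 1 = A 1 0 * v 0 + A 1 1 * v 1 := by
  simp [matC, Matrix.ofLp_toEuclideanCLM, Matrix.mulVec, dotProduct, Fin.sum_univ_two]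

theorem matC_mul_apply (A B : Matrix (Fin 2) (Fin 2) ℂ) (v : C2) :
    matC (A * B) v = matC A (matC B v) := by
  simp [matC]

theorem matC_one_apply (v : C2) : matC 1 v = v := by
  simp [matC]

theorem matC_sub_apply (A B : Matrix (Fin 2) (Fin 2) ℂ) (v : C2) :
    matC (A - B) v = matC A v - matC B v := by
  simp [matC]

theorem matC_smul_apply (c : ℂ) (A : Matrix (Fin 2) (Fin 2) ℂ) (v : C2) :
    matC (c • A) v = c • matC A v := by
  simp [matC]

theorem matC_neg_apply (A : Matrix (Fin 2) (Fin 2) ℂ) (v : C2) :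
    matC (-A) v = -matC A v := by
  simp [matC]

theorem coeFn_matMul (A : Matrix (Fin 2) (Fin 2) ℂ) (f : L2) :
    matMul A f =ᵐ[vol] fun t => matC A (f t) :=
  ContinuousLinearMap.coeFn_compLpL _ _

theorem matMul_mul (A B : Matrix (Fin 2) (Fin 2) ℂ) (f : L2) :
    matMul (A * B) f = matMul A (matMul B f) := by
  refine Lp.ext ?_
  filter_upwards [coeFn_matMul (A * B) f, coeFn_matMul A (matMul B f), coeFn_matMul B f]
    with t h1 h2 h3
  rw [h1, h2, h3, matC_mul_apply]

theorem matMul_one (f : L2) : matMul 1 f = f := by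
  refine Lp.ext ?_
  filter_upwards [coeFn_matMul 1 f] with t h1
  rw [h1]; simp [matC]

theorem matMul_smul (c : ℂ) (A : Matrix (Fin 2) (Fin 2) ℂ) (f : L2) :
    matMul (c • A) f = c • matMul A f := by
  refine Lp.ext ?_
  filter_upwards [coeFn_matMul (c • A) f, coeFn_matMul A f, Lp.coeFn_smul c (matMul A f)]
    with t h1 h2 h3
  rw [h1, h3, Pi.smul_apply, h2]; simp [matC]

theorem inner_matC (A : Matrix (Fin 2) (Fin 2) ℂ) (v w : C2) :
    inner ℂ (matC A v) w = inner ℂ v (matC Aᴴ w) := by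
  have : matC Aᴴ = ContinuousLinearMap.adjoint (matC A) := by
    rw [← ContinuousLinearMap.star_eq_adjoint, matC, matC, ← map_star, Matrix.star_eq_conjTranspose]
  rw [this, ContinuousLinearMap.adjoint_inner_right]

theorem inner_matMul (A : Matrix (Fin 2) (Fin 2) ℂ) (f g : L2) :
    inner ℂ (matMul A f) g = inner ℂ f (matMul Aᴴ g) := by
  rw [L2.inner_def, L2.inner_def]
  refine integral_congr_ae ?_
  filter_upwards [coeFn_matMul A f, coeFn_matMul Aᴴ g] with t h1 h2
  rw [h1, h2, inner_matC]

theorem norm_matMul {A : Matrix (Fin 2) (Fin 2) ℂ} (hA : Aᴴ * A = 1) (f : L2) :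
    ‖matMul A f‖ = ‖f‖ := by
  have h : inner ℂ (matMul A f) (matMul A f) = inner ℂ f f := by
    rw [inner_matMul, ← matMul_mul, hA, matMul_one]
  rw [inner_self_eq_norm_sq_to_K, inner_self_eq_norm_sq_to_K] at h
  have h' : ‖matMul A f‖ ^ 2 = ‖f‖ ^ 2 := by exact_mod_cast h
  exact (sq_eq_sq₀ (norm_nonneg _) (norm_nonneg _)).1 h'

/-- Test functions are real valued, so real linearity suffices; this covers constant matrices and
the antilinear charge conjugation alike. -/
theorem HasWeakDeriv.comp_realCLM (L : C2 →L[ℝ] C2) {f g F G : L2} (h : HasWeakDeriv f g)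
    (hF : F =ᵐ[vol] fun t => L (f t)) (hG : G =ᵐ[vol] fun t => L (g t)) : HasWeakDeriv F G := by
  intro φ h1 h2 h3
  have hd : Continuous (deriv φ) := h1.continuous_deriv (by simp)
  have e1 : ∫ t, deriv φ t • F t ∂vol = L (∫ t, deriv φ t • f t ∂vol) := by
    rw [← L.integral_comp_comm (integrable_smul hd h2.deriv f)]
    refine integral_congr_ae ?_
    filter_upwards [hF] with t ht
    rw [ht, map_smul]
  have e2 : ∫ t, φ t • G t ∂vol = L (∫ t, φ t • g t ∂vol) := by
    rw [← L.integral_comp_comm (integrable_smul h1.continuous h2 g)]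
    refine integral_congr_ae ?_
    filter_upwards [hG] with t ht
    rw [ht, map_smul]
  rw [e1, e2, h φ h1 h2 h3, map_neg]

theorem HasWeakDeriv.matMul {f g : L2} (h : HasWeakDeriv f g) (A : Matrix (Fin 2) (Fin 2) ℂ) :
    HasWeakDeriv (matMul A f) (matMul A g) :=
  h.comp_realCLM ((matC A).restrictScalars ℝ) (coeFn_matMul A f) (coeFn_matMul A g)

theorem IsContRep.matMul {f : L2} {u : ℝ → C2} (h : IsContRep f u)
    (A : Matrix (Fin 2) (Fin 2) ℂ) :
    IsContRep (matMul A f) (fun t => matC A (u t)) := by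
  refine ⟨(matC A).continuous.comp_continuousOn h.1, ?_⟩
  filter_upwards [coeFn_matMul A f, h.2] with t h1 h2
  rw [h1, h2]

/-! ### Algebra of the coefficient matrices -/

theorem toC_mul_conj {x : EuclideanSpace ℝ (Fin 2)} (hx : ‖x‖ = 1) :
    toC x * (starRingEnd ℂ) (toC x) = 1 := by
  have h : x 0 ^ 2 + x 1 ^ 2 = 1 := by
    have := EuclideanSpace.norm_sq_eq x
    rw [hx] at this
    simpa [Fin.sum_univ_two] using this.symm
  have h' : ((x 0 : ℂ)) ^ 2 + (x 1 : ℂ) ^ 2 = 1 := by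
    rw [← Complex.ofReal_pow, ← Complex.ofReal_pow, ← Complex.ofReal_add, h, Complex.ofReal_one]
  simp only [toC, map_add, map_mul, Complex.conj_ofReal, Complex.conj_I]
  linear_combination h' - (x 1 : ℂ) ^ 2 * Complex.I_sq

theorem conj_toC_mul {x : EuclideanSpace ℝ (Fin 2)} (hx : ‖x‖ = 1) :
    (starRingEnd ℂ) (toC x) * toC x = 1 := by
  rw [mul_comm, toC_mul_conj hx]

theorem pauliDot_eq (x : EuclideanSpace ℝ (Fin 2)) :
    pauliDot x = !![0, (starRingEnd ℂ) (toC x); toC x, 0] := by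
  ext i j
  fin_cases i <;> fin_cases j <;>
    simp [pauliDot, pauli1, pauli2, toC]; all_goals ring

/-- The Hermitian involution `i (σ · x) σ₃`; the boundary conditions say that the boundary values
at `±1` are eigenvectors of it for the eigenvalue `±1`. -/
def swapMat (x : EuclideanSpace ℝ (Fin 2)) : Matrix (Fin 2) (Fin 2) ℂ :=
  !![0, -(Complex.I * (starRingEnd ℂ) (toC x)); Complex.I * toC x, 0]

theorem pauliDot_conjTranspose (x : EuclideanSpace ℝ (Fin 2)) : (pauliDot x)ᴴ = pauliDot x := by
  rw [pauliDot_eq]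
  ext i j
  fin_cases i <;> fin_cases j <;> simp [Matrix.conjTranspose_apply]

theorem swapMat_conjTranspose (x : EuclideanSpace ℝ (Fin 2)) : (swapMat x)ᴴ = swapMat x := by
  ext i j
  fin_cases i <;> fin_cases j <;> simp [swapMat, Matrix.conjTranspose_apply]

theorem pauli3_conjTranspose : pauli3ᴴ = pauli3 := by
  ext i j
  fin_cases i <;> fin_cases j <;> simp [pauli3, Matrix.conjTranspose_apply]

theorem pauli3_mul_self : pauli3 * pauli3 = 1 := by
  ext i j
  fin_cases i <;> fin_cases j <;> simp [pauli3]

theorem pauliDot_mul_self {x : EuclideanSpace ℝ (Fin 2)} (hx : ‖x‖ = 1) :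
    pauliDot x * pauliDot x = 1 := by
  rw [pauliDot_eq]
  ext i j
  fin_cases i <;> fin_cases j <;> simp [toC_mul_conj hx, conj_toC_mul hx]

theorem swapMat_mul_self {x : EuclideanSpace ℝ (Fin 2)} (hx : ‖x‖ = 1) :
    swapMat x * swapMat x = 1 := by
  have h := toC_mul_conj hx
  ext i j
  fin_cases i <;> fin_cases j <;> simp [swapMat]
  · linear_combination h - toC x * (starRingEnd ℂ) (toC x) * Complex.I_sq
  · linear_combination h - toC x * (starRingEnd ℂ) (toC x) * Complex.I_sq

theorem pauliDot_mul_pauli3 (x : EuclideanSpace ℝ (Fin 2)) :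
    pauliDot x * pauli3 = -Complex.I • swapMat x := by
  rw [pauliDot_eq]
  ext i j
  fin_cases i <;> fin_cases j <;> simp [swapMat, pauli3, ← mul_assoc]

theorem pauliDot_mul_swapMat {x : EuclideanSpace ℝ (Fin 2)} (hx : ‖x‖ = 1) :
    pauliDot x * swapMat x = Complex.I • pauli3 := by
  have h := toC_mul_conj hx
  rw [pauliDot_eq]
  ext i j
  fin_cases i <;> fin_cases j <;> simp [swapMat, pauli3]
  · linear_combination Complex.I * h
  · linear_combination Complex.I * h

theorem swapMat_mul_pauliDot {x : EuclideanSpace ℝ (Fin 2)} (hx : ‖x‖ = 1) :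
    swapMat x * pauliDot x = -(Complex.I • pauli3) := by
  have h := toC_mul_conj hx
  rw [pauliDot_eq]
  ext i j
  fin_cases i <;> fin_cases j <;> simp [swapMat, pauli3]
  · linear_combination Complex.I * h
  · linear_combination Complex.I * h

theorem swapMat_mul_pauli3 (x : EuclideanSpace ℝ (Fin 2)) :
    swapMat x * pauli3 = -(pauli3 * swapMat x) := by
  ext i j
  fin_cases i <;> fin_cases j <;> simp [swapMat, pauli3]

/-- The second row of each eigenvector equation is the boundary condition itself, and the first row
follows from it because x₁ + i x₂ is unimodular. -/
theorem boundaryCond_iff {x : EuclideanSpace ℝ (Fin 2)} (hx : ‖x‖ = 1) {u : ℝ → C2} :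
    BoundaryCond x u ↔ matC (swapMat x) (u 1) = u 1 ∧ matC (swapMat x) (u (-1)) = -u (-1) := by
  have h := toC_mul_conj hx
  have hI := Complex.I_sq
  constructor
  · rintro ⟨h1, h2⟩
    constructor <;> ext i <;> fin_cases i
    · show matC (swapMat x) (u 1) 0 = u 1 0
      rw [matC_apply_zero, h1]
      simp only [swapMat, Matrix.of_apply, Matrix.cons_val]
      linear_combination (-Complex.I ^ 2 * u 1 0) * h - u 1 0 * hI
    · show matC (swapMat x) (u 1) 1 = u 1 1
      rw [matC_apply_one, h1]
      simp [swapMat]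
    · show matC (swapMat x) (u (-1)) 0 = -(u (-1) 0)
      rw [matC_apply_zero, h2]
      simp only [swapMat, Matrix.of_apply, Matrix.cons_val]
      linear_combination (Complex.I ^ 2 * u (-1) 0) * h + u (-1) 0 * hI
    · show matC (swapMat x) (u (-1)) 1 = -(u (-1) 1)
      rw [matC_apply_one, h2]
      simp [swapMat]
  · rintro ⟨h1, h2⟩
    have e1 := congrArg (fun v : C2 => v 1) h1
    have e2 := congrArg (fun v : C2 => v 1) h2
    dsimp only at e1 e2
    rw [matC_apply_one] at e1 e2
    simp [swapMat] at e1 e2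
    exact ⟨e1.symm, by rw [e2, neg_neg]⟩

/-! ### Elementary properties of the transverse operator -/

theorem hasWeakDeriv_domDeriv {x : EuclideanSpace ℝ (Fin 2)} (f : transverseDomain x) :
    HasWeakDeriv f (domDeriv x f) :=
  hasWeakDeriv_weakDeriv (Submodule.inclusion (transverseDomain_le x) f)

theorem boundaryCond_of_mem {x : EuclideanSpace ℝ (Fin 2)} {f : L2} (hf : f ∈ transverseDomain x)
    {u : ℝ → C2} (hu : IsContRep f u) : BoundaryCond x u := by
  obtain ⟨-, v, hv, h1, h2⟩ := hf
  have e := hu.eqOn hv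
  have e1 := e (by simp : (1 : ℝ) ∈ Set.Icc (-1 : ℝ) 1)
  have e2 := e (by simp : (-1 : ℝ) ∈ Set.Icc (-1 : ℝ) 1)
  exact ⟨by rw [e1]; exact h1, by rw [e2]; exact h2⟩

theorem transverseOp_apply (x : EuclideanSpace ℝ (Fin 2)) (δ : ℝ) (f : transverseDomain x) :
    transverseOp x δ f =
      (-Complex.I) • matMul (pauliDot x) (domDeriv x f) + (δ : ℂ) • matMul pauli3 f := rfl

theorem domDeriv_eq {x : EuclideanSpace ℝ (Fin 2)} {f g : L2} (hf : f ∈ transverseDomain x)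
    (h : HasWeakDeriv f g) : domDeriv x ⟨f, hf⟩ = g :=
  (hasWeakDeriv_domDeriv ⟨f, hf⟩).unique h

theorem transverseOp_mk {x : EuclideanSpace ℝ (Fin 2)} (δ : ℝ) {f g : L2}
    (hf : f ∈ transverseDomain x) (h : HasWeakDeriv f g) :
    transverseOp x δ ⟨f, hf⟩ =
      (-Complex.I) • matMul (pauliDot x) g + (δ : ℂ) • matMul pauli3 f := by
  refine (transverseOp_apply x δ ⟨f, hf⟩).trans ?_
  rw [domDeriv_eq hf h]

/-- The transverse operator is symmetric. -/
theorem inner_transverseOp {x : EuclideanSpace ℝ (Fin 2)} (hx : ‖x‖ = 1) (δ : ℝ)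
    (f g : transverseDomain x) :
    inner ℂ (transverseOp x δ f) (g : L2) = inner ℂ (f : L2) (transverseOp x δ g) := by
  have hf := hasWeakDeriv_domDeriv f
  have hg := hasWeakDeriv_domDeriv g
  obtain ⟨u, hu⟩ := hf.exists_isContRep
  obtain ⟨v, hv⟩ := hg.exists_isContRep
  obtain ⟨u1, u2⟩ := boundaryCond_of_mem f.2 hu
  obtain ⟨v1, v2⟩ := boundaryCond_of_mem g.2 hv
  have key := hf.inner_add_inner (hg.matMul (pauliDot x)) hu (hv.matMul (pauliDot x))
  have h := toC_mul_conj hx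
  have b : ∀ a b : C2, inner ℂ a (matC (pauliDot x) b) =
      (starRingEnd ℂ) (a 0) * ((starRingEnd ℂ) (toC x) * b 1) +
        (starRingEnd ℂ) (a 1) * (toC x * b 0) := fun a b => by
    rw [PiLp.inner_apply, Fin.sum_univ_two, matC_apply_zero, matC_apply_one, pauliDot_eq]
    simp
    ring
  -- At each endpoint the boundary conditions make the two summands of ⟨u, (σ·x) v⟩ opposite, so the
  -- boundary terms vanish.
  rw [b, b, u1, u2, v1, v2] at key
  simp only [map_mul, map_neg, Complex.conj_I] at key
  rw [transverseOp_apply, transverseOp_apply, inner_add_left, inner_add_right, inner_smul_left,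
    inner_smul_left, inner_smul_right, inner_smul_right, inner_matMul, inner_matMul,
    pauliDot_conjTranspose, pauli3_conjTranspose]
  simp only [map_neg, Complex.conj_I, Complex.conj_ofReal]
  linear_combination Complex.I * key

/-- Since (σ·x)σ₃ = -iB, the cross term is 2δ Re⟨f', Bf⟩. As B is Hermitian, 2 Re⟨f', Bf⟩ is the
jump of ⟨u, Bu⟩ between the endpoints, and the value of B, namely 1 at 1 and -1 at -1, turns this
jump into a sum of squares. -/
theorem norm_sq_transverseOp {x : EuclideanSpace ℝ (Fin 2)} (hx : ‖x‖ = 1) (δ : ℝ)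
    (f : transverseDomain x) {u : ℝ → C2} (hu : IsContRep (f : L2) u) :
    ‖transverseOp x δ f‖ ^ 2 =
      ‖domDeriv x f‖ ^ 2 + δ ^ 2 * ‖(f : L2)‖ ^ 2 + δ * (‖u 1‖ ^ 2 + ‖u (-1)‖ ^ 2) := by
  have hf := hasWeakDeriv_domDeriv f
  obtain ⟨b1, b2⟩ := (boundaryCond_iff hx).1 (boundaryCond_of_mem f.2 hu)
  have key := hf.inner_add_inner (hf.matMul (swapMat x)) hu (hu.matMul (swapMat x))
  have hre : RCLike.re (inner ℂ (domDeriv x f) (matMul (swapMat x) f)) =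
      RCLike.re (inner ℂ (f : L2) (matMul (swapMat x) (domDeriv x f))) := by
    rw [← inner_conj_symm, RCLike.conj_re, inner_matMul, swapMat_conjTranspose]
  have key' := congrArg RCLike.re key
  rw [b1, b2, inner_neg_right, map_add, map_sub, map_neg, ← hre, inner_self_eq_norm_sq,
    inner_self_eq_norm_sq] at key'
  have cross : inner ℂ ((-Complex.I) • matMul (pauliDot x) (domDeriv x f))
      ((δ : ℂ) • matMul pauli3 (f : L2)) =
      (δ : ℂ) * inner ℂ (domDeriv x f) (matMul (swapMat x) f) := by
    rw [inner_smul_left, inner_smul_right, inner_matMul, pauliDot_conjTranspose, ← matMul_mul,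
      pauliDot_mul_pauli3, matMul_smul, inner_smul_right]
    simp only [map_neg, Complex.conj_I]
    linear_combination (-(δ : ℂ) * inner ℂ (domDeriv x f) (matMul (swapMat x) f)) * Complex.I_sq
  have n1 : ‖(-Complex.I) • matMul (pauliDot x) (domDeriv x f)‖ = ‖domDeriv x f‖ := by
    rw [norm_smul, norm_neg, Complex.norm_I, one_mul, norm_matMul]
    rw [pauliDot_conjTranspose, pauliDot_mul_self hx]
  have n2 : ‖(δ : ℂ) • matMul pauli3 (f : L2)‖ = |δ| * ‖(f : L2)‖ := by
    rw [norm_smul, norm_matMul (by rw [pauli3_conjTranspose, pauli3_mul_self]), Complex.norm_real,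
      Real.norm_eq_abs]
  rw [transverseOp_apply, @norm_add_sq ℂ, cross, n1, n2, mul_pow, sq_abs]
  have : RCLike.re ((δ : ℂ) * inner ℂ (domDeriv x f) (matMul (swapMat x) (f : L2))) =
      δ * RCLike.re (inner ℂ (domDeriv x f) (matMul (swapMat x) (f : L2))) := RCLike.re_ofReal_mul _ _
  rw [this]
  linear_combination δ * key'

/-- An element of the domain with vanishing derivative vanishes. -/
theorem eq_zero_of_domDeriv_eq_zero {x : EuclideanSpace ℝ (Fin 2)} (hx : ‖x‖ = 1)
    {f : transverseDomain x} (h : domDeriv x f = 0) : f = 0 := by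
  have hf := hasWeakDeriv_domDeriv f
  rw [h] at hf
  obtain ⟨c, hc⟩ := ae_const_of_hasWeakDeriv_zero hf
  have hu : IsContRep (f : L2) (fun _ => c) := ⟨continuousOn_const, hc⟩
  obtain ⟨b1, b2⟩ := (boundaryCond_iff hx).1 (boundaryCond_of_mem f.2 hu)
  -- A constant has the same value at both endpoints, so it lies in both eigenspaces of B.
  have hc0 : c = 0 := by
    have h2 : (2 : ℂ) • c = 0 := by
      rw [two_smul]; nth_rw 1 [b1.symm.trans b2]; exact neg_add_cancel c
    exact (smul_eq_zero.1 h2).resolve_left two_ne_zero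
  refine Subtype.ext ((Lp.eq_zero_iff_ae_eq_zero).2 ?_)
  filter_upwards [hc] with t ht
  rw [ht, hc0]; rfl

/-! ### Generalities on unbounded operators -/

section Generalities

variable {H : Type} [NormedAddCommGroup H]

/-- By the resolvent identity S = R(1 + (w - z)S), compactness of one resolvent passes to all
others. -/
theorem hasCompactResolvent_of_isResolvent [NormedSpace ℂ H] {T : H →ₗ.[ℂ] H} {z : ℂ}
    {R : H →L[ℂ] H} (hR : IsResolvent T z R) (hc : IsCompactOperator R) :
    HasCompactResolvent T := by
  refine ⟨⟨z, R, hR⟩, fun w S hS => ?_⟩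
  have e : ∀ y, S y = (R ∘L (ContinuousLinearMap.id ℂ H + (w - z) • S)) y := fun y => by
    obtain ⟨h, hy⟩ := hS.1 y
    have h2 := hR.2 ⟨S y, h⟩
    rw [sub_eq_iff_eq_add.1 hy] at h2
    refine h2.symm.trans ?_
    show R (y + w • S y - z • S y) = R (y + (w - z) • S y)
    rw [sub_smul, add_sub_assoc]
  have : (S : H → H) = R ∘ (ContinuousLinearMap.id ℂ H + (w - z) • S) := funext e
  rw [this]
  exact hc.comp_clm _

/-- The sign s = 1 serves for the equivalence of different x, and s = -1 for the reflection z ↦ -z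
of the spectrum. -/
theorem IsResolvent.conj [NormedSpace ℂ H] {T T' : H →ₗ.[ℂ] H} {z s : ℂ} (hs : s * s = 1)
    {R U U' : H →L[ℂ] H} (hUU' : ∀ y, U (U' y) = y)
    (hU : ∀ f : T.domain, ∃ h : U f ∈ T'.domain, T' ⟨U f, h⟩ = s • U (T f))
    (hU' : ∀ f : T'.domain, ∃ h : U' f ∈ T.domain, T ⟨U' f, h⟩ = s • U' (T' f))
    (hR : IsResolvent T z R) : IsResolvent T' (s * z) (s • (U ∘L R ∘L U')) := by
  constructor
  · intro y
    obtain ⟨h, hy⟩ := hR.1 (U' y)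
    obtain ⟨h', hy'⟩ := hU ⟨R (U' y), h⟩
    refine ⟨T'.domain.smul_mem s h', ?_⟩
    have e := T'.map_smul s ⟨U (R (U' y)), h'⟩
    refine (congrArg (fun w => w - (s * z) • (s • U (R (U' y)))) e).trans ?_
    rw [hy', sub_eq_iff_eq_add.1 hy, smul_smul, hs, one_smul, map_add, hUU', map_smul, smul_smul,
      show s * z * s = z by linear_combination z * hs, add_sub_cancel_right]
  · intro f
    obtain ⟨h', hy'⟩ := hU' f
    have e := hR.2 ⟨U' f, h'⟩
    rw [hy'] at e
    simp only [smul_apply, ContinuousLinearMap.comp_apply, map_sub, map_smul]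
    simp only [map_sub, map_smul] at e
    have e2 := congrArg U e
    rw [hUU', map_sub, map_smul, map_smul] at e2
    rwa [smul_smul (s * z) s, show s * z * s = z by linear_combination z * hs]

/-- Surjectivity does everything. If f is orthogonal to the domain, then ‖Rf‖² = ⟨Rf, T(RRf)⟩ = ⟨f,
RRf⟩ = 0, hence f = T(Rf) = 0 and the domain is dense. -/
theorem isSelfAdjoint_of_isResolvent_zero [InnerProductSpace ℂ H] [CompleteSpace H]
    {T : H →ₗ.[ℂ] H} {R : H →L[ℂ] H} (hR : IsResolvent T 0 R)
    (hT : ∀ f g : T.domain, inner ℂ (T f) (g : H) = inner ℂ (f : H) (T g)) :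
    IsSelfAdjoint T := by
  have hR1 : ∀ y, ∃ h : R y ∈ T.domain, T ⟨R y, h⟩ = y := fun y => by
    obtain ⟨h, hy⟩ := hR.1 y
    exact ⟨h, by simpa using hy⟩
  have hdense : Dense (T.domain : Set H) := by
    rw [Submodule.dense_iff_topologicalClosure_eq_top, Submodule.topologicalClosure_eq_top_iff,
      Submodule.eq_bot_iff]
    intro f hf
    rw [Submodule.mem_orthogonal] at hf
    obtain ⟨h1, e1⟩ := hR1 f
    have : R f = 0 := by
      obtain ⟨h2, e2⟩ := hR1 (R f)
      have h3 := hT ⟨R f, h1⟩ ⟨R (R f), h2⟩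
      rw [e1, e2] at h3
      have h4 := hf _ h2
      rw [← inner_conj_symm, h3] at h4
      simpa using h4
    rw [← e1]
    have h0 : (⟨R f, h1⟩ : T.domain) = 0 := Subtype.ext this
    rw [h0, T.map_zero]
  rw [LinearPMap.isSelfAdjoint_def]
  have hle : T ≤ T.adjoint :=
    LinearPMap.IsFormalAdjoint.le_adjoint hdense hT
  refine le_antisymm ?_ hle
  refine LinearPMap.le_of_le_graph ?_
  rintro ⟨g, w⟩ hgw
  rw [LinearPMap.mem_graph_iff] at hgw
  obtain ⟨⟨g', hg'⟩, rfl, hw⟩ := hgw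
  obtain ⟨h1, e1⟩ := hR1 w
  -- With w = T*g', the vector g' - Rw is orthogonal to the range of T, which is the whole space; so
  -- g' = Rw lies in the domain of T.
  have horth : ∀ f : T.domain, inner ℂ (g' - R w) (T f) = 0 := fun f => by
    have a := LinearPMap.adjoint_isFormalAdjoint hdense ⟨g', hg'⟩ f
    have b := hT ⟨R w, h1⟩ f
    rw [hw] at a
    rw [e1] at b
    simp only at a b
    rw [inner_sub_left, ← a, ← b, sub_self]
  have hz : g' - R w = 0 := by
    obtain ⟨h2, e2⟩ := hR1 (g' - R w)
    have := horth ⟨_, h2⟩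
    rw [e2] at this
    exact inner_self_eq_zero.1 this
  rw [LinearPMap.mem_graph_iff]
  exact ⟨⟨R w, h1⟩, (sub_eq_zero.1 hz).symm, e1⟩

end Generalities

/-! ### The Volterra operator -/

/-- Cauchy–Schwarz on [s, t]. This Hölder bound is the common modulus of continuity needed for
Arzelà–Ascoli. -/
theorem norm_prim_sub_prim_le (g : L2) {s t : ℝ} (h : s ≤ t) :
    ‖prim g t - prim g s‖ ≤ Real.sqrt (t - s) * ‖g‖ := by
  rw [prim_sub_prim (integrable_coe g) h]
  have h1 : eLpNorm g 1 (vol.restrict (Set.Ioc s t)) ≤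
      eLpNorm g 2 vol * ENNReal.ofReal (Real.sqrt (t - s)) := by
    refine (eLpNorm_le_eLpNorm_mul_rpow_measure_univ (p := 1) (q := 2) (by norm_num)
      (Lp.aestronglyMeasurable g).restrict).trans ?_
    refine mul_le_mul' (eLpNorm_mono_measure _ Measure.restrict_le_self) ?_
    rw [Measure.restrict_apply_univ]
    have h2 : vol (Set.Ioc s t) ≤ ENNReal.ofReal (t - s) :=
      (Measure.restrict_le_self _).trans (by rw [Real.volume_Ioc])
    have h3 : (1 / (1 : ENNReal).toReal - 1 / (2 : ENNReal).toReal) = (1 / 2 : ℝ) := by norm_num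
    rw [h3, Real.sqrt_eq_rpow, ← ENNReal.ofReal_rpow_of_nonneg (by linarith) (by norm_num)]
    exact ENNReal.rpow_le_rpow h2 (by norm_num)
  have h4 : eLpNorm g 2 vol * ENNReal.ofReal (Real.sqrt (t - s)) ≠ ⊤ :=
    ENNReal.mul_ne_top (Lp.eLpNorm_ne_top g) ENNReal.ofReal_ne_top
  refine (norm_integral_le_integral_norm _).trans ?_
  rw [integral_norm_eq_lintegral_enorm (Lp.aestronglyMeasurable g).restrict,
    ← eLpNorm_one_eq_lintegral_enorm]
  refine (ENNReal.toReal_mono h4 h1).trans ?_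
  rw [ENNReal.toReal_mul, ENNReal.toReal_ofReal (Real.sqrt_nonneg _), Lp.norm_def, mul_comm]

theorem norm_prim_le (g : L2) {t : ℝ} (ht : t ∈ Set.Icc (-1 : ℝ) 1) : ‖prim g t‖ ≤ 2 * ‖g‖ := by
  have h := norm_prim_sub_prim_le g ht.1
  rw [prim_neg_one, sub_zero] at h
  refine h.trans (mul_le_mul_of_nonneg_right ?_ (norm_nonneg _))
  rw [Real.sqrt_le_left (by norm_num)]
  linarith [ht.2]

theorem prim_add (f g : L2) : prim (f + g : L2) = prim f + prim g := by
  rw [prim_congr (Lp.coeFn_add f g)]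
  funext t
  exact integral_add (integrable_coe f).integrableOn (integrable_coe g).integrableOn

theorem prim_smul (c : ℂ) (f : L2) : prim (c • f : L2) = c • prim f := by
  rw [prim_congr (Lp.coeFn_smul c f)]
  funext t
  exact integral_smul c _

/-- The primitive of an element of `L²`, as a continuous function on `[-1,1]`. -/
def primBCF (g : L2) : BoundedContinuousFunction (Set.Icc (-1 : ℝ) 1) C2 :=
  BoundedContinuousFunction.mkOfCompact
    ⟨fun t => prim g t, (continuous_prim (integrable_coe g)).comp continuous_subtype_val⟩

theorem isCompactOperator_primBCF : IsCompactOperator primBCF := by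
  refine ⟨closure (primBCF '' Metric.ball 0 1), ?_, ?_⟩
  · refine BoundedContinuousFunction.arzela_ascoli (Metric.closedBall 0 2)
      (isCompact_closedBall 0 2) _ ?_ ?_
    · rintro _ t ⟨g, hg, rfl⟩
      rw [mem_closedBall_zero_iff]
      rw [mem_ball_zero_iff] at hg
      have := norm_prim_le g t.2
      show ‖prim g t‖ ≤ 2
      linarith
    · refine Metric.equicontinuous_of_continuity_modulus Real.sqrt ?_ _ ?_
      · have := Real.continuous_sqrt.tendsto 0
        rwa [Real.sqrt_zero] at this
      · rintro s t ⟨_, g, hg, rfl⟩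
        rw [mem_ball_zero_iff] at hg
        show dist (prim g s) (prim g t) ≤ Real.sqrt |(s : ℝ) - t|
        have aux : ∀ a b : ℝ, a ≤ b → dist (prim g a) (prim g b) ≤ Real.sqrt |a - b| := by
          intro a b hab
          rw [dist_comm, dist_eq_norm, abs_sub_comm, abs_of_nonneg (by linarith)]
          refine (norm_prim_sub_prim_le g hab).trans ?_
          exact mul_le_of_le_one_right (Real.sqrt_nonneg _) hg.le
        rcases le_total (s : ℝ) t with h | h
        · exact aux _ _ h
        · rw [dist_comm, abs_sub_comm]; exact aux _ _ h
  · exact Filter.mem_of_superset (Metric.ball_mem_nhds 0 one_pos)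
      fun g hg => subset_closure ⟨g, hg, rfl⟩

theorem memLp_prim (g : L2) : MemLp (prim g) 2 vol :=
  memLp_of_continuous (continuous_prim (integrable_coe g)) 2

/-- The Volterra operator as a linear map. -/
def volterraLin : L2 →ₗ[ℂ] L2 where
  toFun g := (memLp_prim g).toLp
  map_add' f g := by
    rw [← MemLp.toLp_add, MemLp.toLp_eq_toLp_iff, prim_add]
  map_smul' c f := by
    rw [RingHom.id_apply, ← MemLp.toLp_const_smul, MemLp.toLp_eq_toLp_iff, prim_smul]

theorem isCompactOperator_volterraLin : IsCompactOperator volterraLin := by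
  -- The Volterra operator factors through continuous functions on [-1,1]; composing with the
  -- projection onto the interval extends them to the real line, where elements of L² are
  -- represented.
  let Φ : BoundedContinuousFunction (Set.Icc (-1 : ℝ) 1) C2 → L2 := fun u =>
    BoundedContinuousFunction.toLp 2 vol ℂ
      (u.compContinuous ⟨Set.projIcc (-1 : ℝ) 1 (by norm_num), continuous_projIcc⟩)
  have hΦ : Continuous Φ :=
    (ContinuousLinearMap.continuous _).comp (BoundedContinuousFunction.continuous_compContinuous _)
  have e : (volterraLin : L2 → L2) = Φ ∘ primBCF := by
    funext g
    refine Lp.ext ?_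
    filter_upwards [(memLp_prim g).coeFn_toLp, BoundedContinuousFunction.coeFn_toLp (p := 2)
      (μ := vol) ℂ ((primBCF g).compContinuous
        ⟨Set.projIcc (-1 : ℝ) 1 (by norm_num), continuous_projIcc⟩),
      ae_restrict_mem measurableSet_Ioo] with t h1 h2 ht
    refine h1.trans (Eq.trans ?_ h2.symm)
    show prim g t = prim g (Set.projIcc (-1 : ℝ) 1 (by norm_num) t)
    rw [Set.projIcc_of_mem _ (⟨ht.1.le, ht.2.le⟩ : t ∈ Set.Icc (-1 : ℝ) 1)]
  rw [e]
  exact isCompactOperator_primBCF.continuous_comp hΦ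

/-- The Volterra operator. -/
def volterra : L2 →L[ℂ] L2 :=
  ContinuousLinearMap.mkOfIsCompactOperator isCompactOperator_volterraLin

theorem coeFn_volterra (g : L2) : volterra g =ᵐ[vol] prim g := (memLp_prim g).coeFn_toLp

/-- Integration over `(-1,1)` as a continuous linear map. -/
def integralCLM : L2 →L[ℂ] C2 :=
  LinearMap.mkContinuous
    { toFun := fun g => prim g 1
      map_add' := fun f g => by rw [prim_add]; rfl
      map_smul' := fun c f => by rw [prim_smul]; rfl } 2
    (fun g => norm_prim_le g (by simp))

/-! ### The inverse of the transverse operator -/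

/-- The inverse of the transverse operator for `δ = 0`. -/
def inverseZero (x : EuclideanSpace ℝ (Fin 2)) : L2 →L[ℂ] L2 :=
  (volterra - (Lp.constL 2 vol ℂ ∘L matC ((1 / 2 : ℂ) • (1 - swapMat x))) ∘L integralCLM) ∘L
    (Complex.I • matMul (pauliDot x))

theorem isCompactOperator_inverseZero (x : EuclideanSpace ℝ (Fin 2)) :
    IsCompactOperator (inverseZero x) := by
  refine IsCompactOperator.comp_clm (f := ⇑(volterra - (Lp.constL 2 vol ℂ ∘L
    matC ((1 / 2 : ℂ) • (1 - swapMat x))) ∘L integralCLM)) ?_ (Complex.I • matMul (pauliDot x))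
  refine IsCompactOperator.sub (f := volterra) isCompactOperator_volterraLin ?_
  exact (isCompactOperator_of_locallyCompactSpace_rng (Lp.constL 2 vol ℂ ∘L
    matC ((1 / 2 : ℂ) • (1 - swapMat x)))).comp_clm integralCLM

/-- The equation fixes f up to a constant, f = prim h - c with h = i(σ·x)y. Taking for c the
component of prim h 1 in the (-1)-eigenspace of B meets both conditions: f(-1) = -c lies in that
eigenspace, and f(1) is the remaining (+1)-component. -/
theorem inverseZero_spec {x : EuclideanSpace ℝ (Fin 2)} (hx : ‖x‖ = 1) (y : L2) :
    ∃ h : inverseZero x y ∈ transverseDomain x,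
      domDeriv x ⟨inverseZero x y, h⟩ = Complex.I • matMul (pauliDot x) y := by
  set h : L2 := Complex.I • matMul (pauliDot x) y with hh
  set P : Matrix (Fin 2) (Fin 2) ℂ := (1 / 2 : ℂ) • (1 - swapMat x) with hP
  set c : C2 := matC P (prim h 1) with hc
  have hval : inverseZero x y = volterra h - Lp.const 2 vol c := rfl
  have hae : inverseZero x y =ᵐ[vol] fun t => -c + prim h t := by
    rw [hval]
    filter_upwards [Lp.coeFn_sub (volterra h) (Lp.const 2 vol c), coeFn_volterra h,
      Lp.coeFn_const 2 vol c] with t h1 h2 h3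
    rw [h1, Pi.sub_apply, h2, h3, Function.const_apply]
    abel
  have hw := hasWeakDeriv_of_ae_eq hae
  have e1 : swapMat x * P = -P := by
    rw [hP, Matrix.mul_smul, mul_sub, mul_one, swapMat_mul_self hx, ← smul_neg, neg_sub]
  have hBc : matC (swapMat x) c = -c := by
    rw [hc, ← matC_mul_apply, e1, matC_neg_apply]
  have hB1 : matC (swapMat x) (prim h 1) = prim h 1 - (2 : ℂ) • c := by
    have : swapMat x = 1 - (2 : ℂ) • P := by
      rw [hP, smul_smul]; norm_num
    rw [hc, this, matC_sub_apply, matC_smul_apply, matC_one_apply]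
  have hmem : inverseZero x y ∈ transverseDomain x := by
    refine ⟨⟨h, hw⟩, _, isContRep_of_ae_eq hae, (boundaryCond_iff hx).2 ⟨?_, ?_⟩⟩
    · rw [map_add, map_neg, hBc, hB1, two_smul]; abel
    · rw [prim_neg_one, add_zero, map_neg, hBc]
  exact ⟨hmem, domDeriv_eq hmem hw⟩

theorem eq_zero_of_transverseOp_eq_zero {x : EuclideanSpace ℝ (Fin 2)} (hx : ‖x‖ = 1) {δ : ℝ}
    (hδ : 0 ≤ δ) {f : transverseDomain x} (h : transverseOp x δ f = 0) : f = 0 := by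
  obtain ⟨u, hu⟩ := (hasWeakDeriv_domDeriv f).exists_isContRep
  have key := norm_sq_transverseOp hx δ f hu
  rw [h, norm_zero] at key
  refine eq_zero_of_domDeriv_eq_zero hx (norm_eq_zero.1 ?_)
  have : 0 ≤ δ ^ 2 * ‖(f : L2)‖ ^ 2 + δ * (‖u 1‖ ^ 2 + ‖u (-1)‖ ^ 2) := by positivity
  nlinarith [norm_nonneg (domDeriv x f)]

/-- With A the inverse for δ = 0, one has T A = 1 - K where K = -δσ₃A is compact. A fixed vector y
of K would give T(Ay) = 0, hence Ay = 0 and y = 0; so 1 - K is invertible by the Fredholm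
alternative and A(1 - K)⁻¹ is a right inverse of T. Injectivity of T makes it two-sided. -/
theorem exists_isResolvent_zero {x : EuclideanSpace ℝ (Fin 2)} (hx : ‖x‖ = 1) {δ : ℝ}
    (hδ : 0 ≤ δ) : ∃ R : L2 →L[ℂ] L2, IsResolvent (transverseOp x δ) 0 R ∧ IsCompactOperator R := by
  have hop : ∀ y, ∃ h : inverseZero x y ∈ transverseDomain x,
      transverseOp x δ ⟨inverseZero x y, h⟩ =
        y + (δ : ℂ) • matMul pauli3 (inverseZero x y) := fun y => by
    obtain ⟨h, e⟩ := inverseZero_spec hx y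
    refine ⟨h, (transverseOp_apply x δ ⟨_, h⟩).trans ?_⟩
    rw [e, map_smul, ← matMul_mul, pauliDot_mul_self hx, matMul_one, smul_smul]
    simp
  set K : L2 →L[ℂ] L2 := (-(δ : ℂ)) • (matMul pauli3 ∘L inverseZero x) with hK
  have hKa : ∀ y, K y = -((δ : ℂ) • matMul pauli3 (inverseZero x y)) := fun y =>
    neg_smul (δ : ℂ) (matMul pauli3 (inverseZero x y))
  have hKc : IsCompactOperator K := by
    have h : IsCompactOperator (matMul pauli3 ∘L inverseZero x) :=
      (isCompactOperator_inverseZero x).clm_comp (matMul pauli3)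
    exact h.smul (-(δ : ℂ))
  have hne : ¬ Module.End.HasEigenvalue (K : L2 →ₗ[ℂ] L2) 1 := by
    intro hev
    obtain ⟨y, hy⟩ := hev.exists_hasEigenvector
    have h1 := hy.apply_eq_smul
    rw [one_smul] at h1
    have h1' : K y = y := h1
    rw [hKa] at h1'
    obtain ⟨h, e⟩ := hop y
    rw [neg_eq_iff_eq_neg.1 h1', add_neg_cancel] at e
    have h2 : (⟨inverseZero x y, h⟩ : transverseDomain x) = 0 :=
      eq_zero_of_transverseOp_eq_zero hx hδ e
    have h3 : inverseZero x y = 0 := congrArg Subtype.val h2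
    rw [h3, map_zero, smul_zero, neg_zero] at h1'
    exact hy.2 h1'.symm
  have hunit : IsUnit (algebraMap ℂ (L2 →L[ℂ] L2) 1 - K) :=
    (hKc.hasEigenvalue_or_mem_resolventSet one_ne_zero).resolve_left hne
  obtain ⟨S, hS⟩ := hunit
  have hSS : ∀ y, (S⁻¹ : (L2 →L[ℂ] L2)ˣ).1 y - K ((S⁻¹ : (L2 →L[ℂ] L2)ˣ).1 y) = y := fun y => by
    have h1 : (S.1 * (S⁻¹).1) y = y := by rw [S.mul_inv]; rfl
    have h2 : S.1 ((S⁻¹).1 y) = y := h1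
    rw [hS, map_one] at h2
    exact h2
  refine ⟨inverseZero x ∘L (S⁻¹).1, ⟨fun y => ?_, fun f => ?_⟩,
    (isCompactOperator_inverseZero x).comp_clm _⟩
  · obtain ⟨h, e⟩ := hop ((S⁻¹).1 y)
    refine ⟨h, ?_⟩
    rw [zero_smul, sub_zero]
    refine e.trans ?_
    have := hSS y
    rwa [hKa, sub_neg_eq_add] at this
  · rw [zero_smul, sub_zero]
    obtain ⟨h, e⟩ := hop ((S⁻¹).1 (transverseOp x δ f))
    have e' : transverseOp x δ ⟨_, h⟩ = transverseOp x δ f := by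
      refine e.trans ?_
      have := hSS (transverseOp x δ f)
      rwa [hKa, sub_neg_eq_add] at this
    have hz : transverseOp x δ (⟨_, h⟩ - f) = 0 := by
      rw [LinearPMap.map_sub, e', sub_self]
    have := eq_zero_of_transverseOp_eq_zero hx hδ hz
    exact congrArg Subtype.val (sub_eq_zero.1 this)

theorem isSelfAdjoint_transverseOp {x : EuclideanSpace ℝ (Fin 2)} (hx : ‖x‖ = 1) {δ : ℝ}
    (hδ : 0 ≤ δ) : IsSelfAdjoint (transverseOp x δ) := by
  obtain ⟨R, hR, -⟩ := exists_isResolvent_zero hx hδ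
  exact isSelfAdjoint_of_isResolvent_zero hR (inner_transverseOp hx δ)

theorem hasCompactResolvent_transverseOp {x : EuclideanSpace ℝ (Fin 2)} (hx : ‖x‖ = 1) {δ : ℝ}
    (hδ : 0 ≤ δ) : HasCompactResolvent (transverseOp x δ) := by
  obtain ⟨R, hR, hc⟩ := exists_isResolvent_zero hx hδ
  exact hasCompactResolvent_of_isResolvent hR hc

/-! ### Symmetries of the spectrum -/

/-- Compatibility with B preserves the boundary conditions; the first two identities carry the
differential part and the mass term with the same sign s. -/
theorem matMul_intertwines {x y : EuclideanSpace ℝ (Fin 2)} (hx : ‖x‖ = 1) (hy : ‖y‖ = 1) (δ : ℝ)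
    {A : Matrix (Fin 2) (Fin 2) ℂ} {s : ℂ} (h1 : pauliDot y * A = s • (A * pauliDot x))
    (h2 : pauli3 * A = s • (A * pauli3)) (h3 : swapMat y * A = A * swapMat x)
    (f : (transverseOp x δ).domain) :
    ∃ h : matMul A f ∈ (transverseOp y δ).domain,
      transverseOp y δ ⟨matMul A f, h⟩ = s • matMul A (transverseOp x δ f) := by
  have hf := hasWeakDeriv_domDeriv (x := x) f
  obtain ⟨u, hu⟩ := hf.exists_isContRep
  obtain ⟨b1, b2⟩ := (boundaryCond_iff hx).1 (boundaryCond_of_mem f.2 hu)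
  have hmem : matMul A f ∈ transverseDomain y := by
    refine ⟨⟨_, hf.matMul A⟩, _, hu.matMul A, (boundaryCond_iff hy).2 ⟨?_, ?_⟩⟩
    · rw [← matC_mul_apply, h3, matC_mul_apply, b1]
    · rw [← matC_mul_apply, h3, matC_mul_apply, b2, map_neg]
  refine ⟨hmem, (transverseOp_mk δ hmem (hf.matMul A)).trans ?_⟩
  refine Eq.trans ?_ (congrArg (fun w => s • matMul A w) (transverseOp_apply x δ f)).symm
  beta_reduce
  rw [map_add, map_smul, map_smul, ← matMul_mul, ← matMul_mul, h1, h2,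
    matMul_smul, matMul_smul, matMul_mul, matMul_mul, smul_add, smul_comm s, smul_comm s]

/-- B preserves the boundary conditions and anticommutes with both coefficient matrices, so BTB =
-T. Being linear, it gives z ↦ -z, whereas an antilinear symmetry would also conjugate z. -/
theorem neg_mem_resolventSet {x : EuclideanSpace ℝ (Fin 2)} (hx : ‖x‖ = 1) (δ : ℝ) {z : ℂ}
    (h : z ∈ resolventSet (transverseOp x δ)) : -z ∈ resolventSet (transverseOp x δ) := by
  obtain ⟨R, hR⟩ := h
  have h1 : pauliDot x * swapMat x = (-1 : ℂ) • (swapMat x * pauliDot x) := by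
    rw [pauliDot_mul_swapMat hx, swapMat_mul_pauliDot hx]; simp
  have h2 : pauli3 * swapMat x = (-1 : ℂ) • (swapMat x * pauli3) := by
    rw [swapMat_mul_pauli3]; simp
  have hi := matMul_intertwines hx hx δ h1 h2 rfl
  have := hR.conj (T' := transverseOp x δ) (s := -1) (by norm_num) (U := matMul (swapMat x))
    (U' := matMul (swapMat x))
    (fun y => by rw [← matMul_mul, swapMat_mul_self hx, matMul_one]) hi hi
  rw [neg_one_mul] at this
  exact ⟨_, this⟩

/-- The matrix `diag(1, ω_y / ω_x)`, which intertwines the operators for `x` and `y`. -/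
def rotMat (x y : EuclideanSpace ℝ (Fin 2)) : Matrix (Fin 2) (Fin 2) ℂ :=
  !![1, 0; 0, toC y * (starRingEnd ℂ) (toC x)]

theorem rotMat_intertwines {x y : EuclideanSpace ℝ (Fin 2)} (hx : ‖x‖ = 1) (hy : ‖y‖ = 1) (δ : ℝ)
    (f : (transverseOp x δ).domain) :
    ∃ h : matMul (rotMat x y) f ∈ (transverseOp y δ).domain,
      transverseOp y δ ⟨matMul (rotMat x y) f, h⟩ =
        (1 : ℂ) • matMul (rotMat x y) (transverseOp x δ f) := by
  have ex := toC_mul_conj hx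
  have ey := toC_mul_conj hy
  refine matMul_intertwines hx hy δ ?_ ?_ ?_ f
  · rw [pauliDot_eq, pauliDot_eq]
    ext i j
    fin_cases i <;> fin_cases j <;> simp [rotMat]
    · linear_combination (starRingEnd ℂ) (toC x) * ey
    · linear_combination -toC y * ex
  · ext i j
    fin_cases i <;> fin_cases j <;> simp [rotMat, pauli3]
  · ext i j
    fin_cases i <;> fin_cases j <;> simp [rotMat, swapMat]
    · linear_combination Complex.I * (starRingEnd ℂ) (toC x) * ey
    · linear_combination -Complex.I * toC y * ex

theorem resolventSet_subset {x y : EuclideanSpace ℝ (Fin 2)} (hx : ‖x‖ = 1) (hy : ‖y‖ = 1)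
    (δ : ℝ) : resolventSet (transverseOp x δ) ⊆ resolventSet (transverseOp y δ) := by
  rintro z ⟨R, hR⟩
  have ex := toC_mul_conj hx
  have ey := toC_mul_conj hy
  have e : rotMat x y * rotMat y x = 1 := by
    ext i j
    fin_cases i <;> fin_cases j <;> simp [rotMat]
    linear_combination ey + toC y * (starRingEnd ℂ) (toC y) * ex
  have := hR.conj (T' := transverseOp y δ) (s := 1) (by norm_num) (U := matMul (rotMat x y))
    (U' := matMul (rotMat y x)) (fun w => by rw [← matMul_mul, e, matMul_one])
    (rotMat_intertwines hx hy δ) (rotMat_intertwines hy hx δ)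
  rw [one_mul] at this
  exact ⟨_, this⟩

theorem spectrum_eq {x y : EuclideanSpace ℝ (Fin 2)} (hx : ‖x‖ = 1) (hy : ‖y‖ = 1) (δ : ℝ) :
    spectrum (transverseOp x δ) = spectrum (transverseOp y δ) :=
  congrArg compl ((resolventSet_subset hx hy δ).antisymm (resolventSet_subset hy hx δ))

theorem mem_spectrum_iff_neg_mem {x : EuclideanSpace ℝ (Fin 2)} (hx : ‖x‖ = 1) (δ : ℝ) (z : ℂ) :
    z ∈ spectrum (transverseOp x δ) ↔ -z ∈ spectrum (transverseOp x δ) := by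
  refine not_congr ⟨neg_mem_resolventSet hx δ, fun h => ?_⟩
  simpa using neg_mem_resolventSet hx δ h

/-! ### The secular equation -/

theorem strictMonoOn_phase {δ : ℝ} (hδ : 0 ≤ δ) :
    StrictMonoOn (fun k : ℝ => 2 * k - Real.arctan (δ / k)) (Set.Ioi 0) := by
  intro a ha b hb hab
  have h1 : δ / b ≤ δ / a := div_le_div_of_nonneg_left hδ ha hab.le
  have h2 := Real.arctan_strictMono.monotone h1
  dsimp only
  linarith

/-- Since the arctangent lies in [0, π/2), the phase is at most the target value at (2j-1)π/4 and at
least that value at jπ/2. -/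
theorem exists_waveNumber {δ : ℝ} (hδ : 0 ≤ δ) {j : ℕ} (hj : 1 ≤ j) :
    ∃ k : ℝ, 0 < k ∧ 2 * k - Real.arctan (δ / k) = (2 * j - 1) * Real.pi / 2 := by
  have hj' : (1 : ℝ) ≤ j := by exact_mod_cast hj
  have hpi := Real.pi_pos
  set a : ℝ := (2 * j - 1) * Real.pi / 4 with ha
  set b : ℝ := j * Real.pi / 2 with hb
  have ha0 : 0 < a := by
    have : (0 : ℝ) < 2 * j - 1 := by linarith
    positivity
  have hab : a ≤ b := by rw [ha, hb]; nlinarith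
  have hc : ContinuousOn (fun k : ℝ => 2 * k - Real.arctan (δ / k)) (Set.Icc a b) := by
    refine (continuousOn_const.mul continuousOn_id).sub
      (Real.continuous_arctan.comp_continuousOn (continuousOn_const.div continuousOn_id ?_))
    intro k hk
    exact (ha0.trans_le hk.1).ne'
  obtain ⟨k, hk, e⟩ := intermediate_value_Icc hab hc
    (show (2 * j - 1) * Real.pi / 2 ∈ Set.Icc _ _ from ⟨by
      have := Real.arctan_nonneg.2 (div_nonneg hδ ha0.le)
      rw [ha] at this ⊢
      linarith, by
      have := Real.arctan_lt_pi_div_two (δ / b)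
      rw [hb] at this ⊢
      linarith⟩)
  exact ⟨k, ha0.trans_le hk.1, e⟩

/-- The `j`-th positive solution `k` of `k cos 2k + δ sin 2k = 0`, for `δ ≥ 0` and `j ≥ 1`. -/
def waveNumber (δ : ℝ) (j : ℕ) : ℝ :=
  if h : 0 ≤ δ ∧ 1 ≤ j then Classical.choose (exists_waveNumber h.1 h.2) else 0

theorem waveNumber_spec {δ : ℝ} (hδ : 0 ≤ δ) {j : ℕ} (hj : 1 ≤ j) :
    0 < waveNumber δ j ∧
      2 * waveNumber δ j - Real.arctan (δ / waveNumber δ j) = (2 * j - 1) * Real.pi / 2 := by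
  rw [waveNumber, dif_pos ⟨hδ, hj⟩]
  exact Classical.choose_spec (exists_waveNumber hδ hj)

theorem waveNumber_pos {δ : ℝ} (hδ : 0 ≤ δ) {j : ℕ} (hj : 1 ≤ j) : 0 < waveNumber δ j :=
  (waveNumber_spec hδ hj).1

theorem le_waveNumber {δ : ℝ} (hδ : 0 ≤ δ) {j : ℕ} (hj : 1 ≤ j) :
    (2 * j - 1) * Real.pi / 4 ≤ waveNumber δ j := by
  obtain ⟨h1, h2⟩ := waveNumber_spec hδ hj
  have := Real.arctan_nonneg.2 (div_nonneg hδ h1.le)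
  linarith

theorem waveNumber_le {δ : ℝ} (hδ : 0 ≤ δ) {j : ℕ} (hj : 1 ≤ j) :
    waveNumber δ j ≤ j * (Real.pi / 2) := by
  obtain ⟨h1, h2⟩ := waveNumber_spec hδ hj
  have := Real.arctan_lt_pi_div_two (δ / waveNumber δ j)
  linarith

theorem waveNumber_lt_waveNumber {δ : ℝ} (hδ : 0 ≤ δ) {i j : ℕ} (hi : 1 ≤ i) (hij : i < j) :
    waveNumber δ i < waveNumber δ j := by
  obtain ⟨h1, h2⟩ := waveNumber_spec hδ hi
  obtain ⟨h3, h4⟩ := waveNumber_spec hδ (hi.trans hij.le)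
  rw [← (strictMonoOn_phase hδ).lt_iff_lt h1 h3]
  rw [h2, h4]
  have : (i : ℝ) < j := by exact_mod_cast hij
  have := Real.pi_pos
  nlinarith

/-- With a = arctan(δ/k), the left side times cos a > 0 is cos(2k - a), so its zeros are the points
where the strictly increasing phase is an odd multiple of π/2. -/
theorem secular_iff {δ k : ℝ} (hδ : 0 ≤ δ) (hk : 0 < k) :
    Real.cos (2 * k) + δ / k * Real.sin (2 * k) = 0 ↔ ∃ j : ℕ, 1 ≤ j ∧ waveNumber δ j = k := by
  set a := Real.arctan (δ / k) with ha
  have hca : 0 < Real.cos a := Real.cos_arctan_pos _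
  have hsa : Real.sin a = δ / k * Real.cos a := by
    rw [← Real.tan_mul_cos hca.ne', ha, Real.tan_arctan]
  have e : Real.cos (2 * k - a) =
      Real.cos a * (Real.cos (2 * k) + δ / k * Real.sin (2 * k)) := by
    rw [Real.cos_sub, hsa]; ring
  have hiff : Real.cos (2 * k) + δ / k * Real.sin (2 * k) = 0 ↔ Real.cos (2 * k - a) = 0 := by
    rw [e, mul_eq_zero, or_iff_right hca.ne']
  rw [hiff, Real.cos_eq_zero_iff]
  have hpi := Real.pi_pos
  constructor
  · rintro ⟨n, hn⟩
    have ha' := Real.arctan_lt_pi_div_two (δ / k)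
    -- For k > 0 the phase exceeds -π/2, so only n ≥ 0 occurs in (2n+1)π/2; the index is j = n + 1.
    have hn0 : (-1 : ℝ) < n := by
      rw [← ha] at ha'
      by_contra hcon
      have : (n : ℝ) ≤ -1 := not_lt.1 hcon
      nlinarith
    have hn1 : (-1 : ℤ) < n := by exact_mod_cast hn0
    obtain ⟨m, rfl⟩ := Int.eq_ofNat_of_zero_le (show 0 ≤ n by omega)
    refine ⟨m + 1, by omega, ?_⟩
    obtain ⟨h1, h2⟩ := waveNumber_spec hδ (show 1 ≤ m + 1 by omega)
    refine (strictMonoOn_phase hδ).injOn h1 hk ?_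
    rw [h2, ← ha, hn]
    push_cast
    ring
  · rintro ⟨j, hj, rfl⟩
    refine ⟨(j : ℤ) - 1, ?_⟩
    rw [ha, (waveNumber_spec hδ hj).2]
    push_cast
    ring

/-- The `j`-th positive eigenvalue of the transverse operator. -/
def eigenvalueSeq (δ : ℝ) (j : ℕ) : ℝ := Real.sqrt (waveNumber δ j ^ 2 + δ ^ 2)

theorem eigenvalueSeq_sq (δ : ℝ) (j : ℕ) :
    eigenvalueSeq δ j ^ 2 = waveNumber δ j ^ 2 + δ ^ 2 :=
  Real.sq_sqrt (by positivity)

theorem eigenvalueSeq_pos {δ : ℝ} (hδ : 0 ≤ δ) {j : ℕ} (hj : 1 ≤ j) : 0 < eigenvalueSeq δ j := by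
  have := waveNumber_pos hδ hj
  exact Real.sqrt_pos.2 (by positivity)

theorem eigenvalueSeq_lt {δ : ℝ} (hδ : 0 ≤ δ) {i j : ℕ} (hi : 1 ≤ i) (hij : i < j) :
    eigenvalueSeq δ i < eigenvalueSeq δ j := by
  refine Real.sqrt_lt_sqrt (by positivity) ?_
  have h1 := waveNumber_lt_waveNumber hδ hi hij
  have h2 := waveNumber_pos hδ hi
  nlinarith

theorem eigenvalueSeq_eq_iff {δ μ : ℝ} (hδ : 0 ≤ δ) (hμ : 0 < μ) {k : ℝ} (hk : 0 < k)
    (hkμ : k ^ 2 = μ ^ 2 - δ ^ 2) {j : ℕ} (hj : 1 ≤ j) :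
    eigenvalueSeq δ j = μ ↔ waveNumber δ j = k := by
  rw [← sq_eq_sq₀ (eigenvalueSeq_pos hδ hj).le hμ.le, ← sq_eq_sq₀ (waveNumber_pos hδ hj).le hk.le,
    eigenvalueSeq_sq, hkμ]
  constructor <;> intro h <;> linarith

theorem eigenvalueSeq_bounds {δ : ℝ} (hδ : 0 ≤ δ) {j : ℕ} (hj : 1 ≤ j) :
    (2 * (j : ℝ) - 1) ^ 2 * (Real.pi ^ 2 / 16) ≤ eigenvalueSeq δ j ^ 2 - δ ^ 2 ∧
      eigenvalueSeq δ j ^ 2 - δ ^ 2 ≤ (j : ℝ) ^ 2 * (Real.pi ^ 2 / 4) := by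
  have hj' : (1 : ℝ) ≤ j := by exact_mod_cast hj
  have hpi := Real.pi_pos
  have h0 : 0 ≤ (2 * (j : ℝ) - 1) * Real.pi / 4 := by
    have : (0 : ℝ) < 2 * j - 1 := by linarith
    positivity
  have h1 := pow_le_pow_left₀ h0 (le_waveNumber hδ hj) 2
  have h2 := pow_le_pow_left₀ (waveNumber_pos hδ hj).le (waveNumber_le hδ hj) 2
  rw [eigenvalueSeq_sq, add_sub_cancel_right]
  constructor
  · calc _ = ((2 * (j : ℝ) - 1) * Real.pi / 4) ^ 2 := by ring
      _ ≤ _ := h1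
  · calc _ ≤ _ := h2
      _ = _ := by ring

/-! ### Asymptotics of the eigenvalues -/

theorem arctan_le_self {y : ℝ} (hy : 0 ≤ y) : Real.arctan y ≤ y := by
  have hm : MonotoneOn (fun y : ℝ => y - Real.arctan y) (Set.Ici 0) := by
    refine monotoneOn_of_deriv_nonneg (convex_Ici 0) (by fun_prop)
      (differentiable_id.sub Real.differentiable_arctan).differentiableOn fun t _ => ?_
    have : HasDerivAt (fun y : ℝ => y - Real.arctan y) (1 - 1 / (1 + t ^ 2)) t :=
      (hasDerivAt_id t).sub (Real.hasDerivAt_arctan t)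
    rw [this.deriv, sub_nonneg, div_le_one (by positivity)]
    nlinarith
  have := hm Set.self_mem_Ici hy hy
  simp only [Real.arctan_zero, sub_zero] at this
  linarith

/-- The constant is not sharp; only the cubic order of the error matters for the expansion. -/
theorem self_sub_cube_le_arctan {y : ℝ} (hy : 0 ≤ y) : y - y ^ 3 ≤ Real.arctan y := by
  have hm : MonotoneOn (fun y : ℝ => Real.arctan y - (y - y ^ 3)) (Set.Ici 0) := by
    refine monotoneOn_of_deriv_nonneg (convex_Ici 0) (by fun_prop)
      (Real.differentiable_arctan.sub (differentiable_id.sub (differentiable_pow 3))).differentiableOn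
      fun t _ => ?_
    have : HasDerivAt (fun y : ℝ => Real.arctan y - (y - y ^ 3))
        (1 / (1 + t ^ 2) - (1 - 3 * t ^ 2)) t :=
      (Real.hasDerivAt_arctan t).sub ((hasDerivAt_id t).sub (hasDerivAt_pow 3 t))
    rw [this.deriv]
    have h0 : 0 < 1 + t ^ 2 := by positivity
    rw [show 1 / (1 + t ^ 2) - (1 - 3 * t ^ 2) = (2 * t ^ 2 + 3 * t ^ 4) / (1 + t ^ 2) by
      field_simp; ring]
    positivity
  have := hm Set.self_mem_Ici hy hy
  simp only [Real.arctan_zero] at this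
  norm_num at this
  linarith

theorem waveNumber_sub_le {δ : ℝ} (hδ : 0 ≤ δ) {j : ℕ} (hj : 1 ≤ j) :
    waveNumber δ j - (2 * j - 1) * Real.pi / 4 ≤ δ := by
  obtain ⟨h1, h2⟩ := waveNumber_spec hδ hj
  have h3 := arctan_le_self (div_nonneg hδ h1.le)
  have hj' : (1 : ℝ) ≤ j := by exact_mod_cast hj
  have h4 : 1 / 2 ≤ waveNumber δ j := by
    have := le_waveNumber hδ hj
    have := Real.pi_gt_three
    nlinarith
  have h5 : δ / waveNumber δ j ≤ 2 * δ := by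
    rw [div_le_iff₀ h1]; nlinarith
  linarith

theorem waveNumber_le_eigenvalueSeq (δ : ℝ) (j : ℕ) :
    waveNumber δ j ≤ eigenvalueSeq δ j :=
  Real.le_sqrt_of_sq_le (by nlinarith [sq_nonneg δ])

theorem eigenvalueSeq_le {δ : ℝ} (hδ : 0 ≤ δ) {j : ℕ} (hj : 1 ≤ j) :
    eigenvalueSeq δ j ≤ waveNumber δ j + δ := by
  have := waveNumber_pos hδ hj
  refine Real.sqrt_le_iff.2 ⟨by positivity, ?_⟩
  nlinarith [mul_nonneg this.le hδ]

theorem eigenvalueSeq_asymptotics {j : ℕ} (hj : 1 ≤ j) :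
    (fun δ : ℝ => eigenvalueSeq δ j -
      ((2 * (j : ℝ) - 1) * Real.pi / 4 + 2 / ((2 * (j : ℝ) - 1) * Real.pi) * δ +
        (-16 / ((2 * (j : ℝ) - 1) ^ 3 * Real.pi ^ 3) +
          2 / ((2 * (j : ℝ) - 1) * Real.pi)) * δ ^ 2))
      =O[nhdsWithin 0 (Set.Ici 0)] (fun δ : ℝ => δ ^ 3) := by
  have hj' : (1 : ℝ) ≤ j := by exact_mod_cast hj
  have hpi := Real.pi_pos
  have h2j : (0 : ℝ) < 2 * j - 1 := by linarith
  set c : ℝ := (2 * (j : ℝ) - 1) * Real.pi / 4 with hc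
  have hc0 : 0 < c := by positivity
  set l := nhdsWithin (0 : ℝ) (Set.Ici 0) with hl
  have hev : ∀ᶠ δ in l, 0 ≤ δ := eventually_mem_nhdsWithin
  set k : ℝ → ℝ := fun δ => waveNumber δ j with hk
  set d : ℝ → ℝ := fun δ => k δ - c with hd
  set lam : ℝ → ℝ := fun δ => eigenvalueSeq δ j with hlam
  have o1 : (fun δ : ℝ => δ) =O[l] (fun _ => (1 : ℝ)) :=
    (continuous_id.continuousAt.continuousWithinAt.tendsto).isBigO_one ℝ
  have o21 : (fun δ : ℝ => δ ^ 3) =O[l] (fun δ => δ ^ 2) := by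
    exact ((Asymptotics.isBigO_refl (fun δ : ℝ => δ ^ 2) l).mul o1).congr
      (fun δ => by ring) (fun δ => by ring)
  have bd : d =O[l] (fun δ : ℝ => δ) := by
    refine Asymptotics.IsBigO.of_bound 1 ?_
    filter_upwards [hev] with δ hδ
    have h1 := waveNumber_sub_le hδ hj
    have h2 := le_waveNumber hδ hj
    rw [Real.norm_eq_abs, Real.norm_eq_abs, abs_of_nonneg hδ, one_mul, abs_le]
    constructor <;> simp only [hd, hk, hc] <;> linarith
  have bk : (fun δ => (k δ)⁻¹) =O[l] (fun _ => (1 : ℝ)) := by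
    refine Asymptotics.IsBigO.of_bound c⁻¹ ?_
    filter_upwards [hev] with δ hδ
    have h2 := le_waveNumber hδ hj
    rw [Real.norm_eq_abs, abs_of_nonneg (inv_nonneg.2 (waveNumber_pos hδ hj).le), norm_one, mul_one]
    exact inv_anti₀ hc0 h2
  -- The relation d = ½ arctan(δ/k) says kd = δ/2 up to a cubic error; the expansion of d comes from
  -- iterating this with k = c + d.
  set e : ℝ → ℝ := fun δ => k δ * d δ - δ / 2 with he
  have be : e =O[l] (fun δ => δ ^ 3) := by
    refine Asymptotics.IsBigO.of_bound (c⁻¹ ^ 2) ?_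
    filter_upwards [hev] with δ hδ
    obtain ⟨h0, h1⟩ := waveNumber_spec hδ hj
    have h2 := le_waveNumber hδ hj
    have h3 := arctan_le_self (div_nonneg hδ h0.le)
    have h4 := self_sub_cube_le_arctan (div_nonneg hδ h0.le)
    have h5 : d δ = Real.arctan (δ / k δ) / 2 := by simp only [hd, hk, hc]; linarith
    have hk0 : 0 < k δ := h0
    have h6 : e δ = k δ * (Real.arctan (δ / k δ) - δ / k δ) / 2 := by
      simp only [he, h5]; field_simp
    have h7 : |Real.arctan (δ / k δ) - δ / k δ| ≤ (δ / k δ) ^ 3 := by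
      rw [abs_le]; constructor
      · simp only [hk]; linarith
      · have : 0 ≤ (δ / k δ) ^ 3 := by positivity
        simp only [hk] at this ⊢; linarith
    rw [Real.norm_eq_abs, Real.norm_eq_abs, abs_of_nonneg (by positivity : 0 ≤ δ ^ 3), h6, abs_div,
      abs_mul, abs_of_pos hk0, abs_two]
    have h8 : (k δ)⁻¹ ≤ c⁻¹ := inv_anti₀ hc0 h2
    calc k δ * |Real.arctan (δ / k δ) - δ / k δ| / 2 ≤ k δ * (δ / k δ) ^ 3 / 2 := by gcongr
      _ = (k δ)⁻¹ ^ 2 * δ ^ 3 / 2 := by field_simp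
      _ ≤ (k δ)⁻¹ ^ 2 * δ ^ 3 := by
        have : 0 ≤ (k δ)⁻¹ ^ 2 * δ ^ 3 := by positivity
        linarith
      _ ≤ c⁻¹ ^ 2 * δ ^ 3 := by gcongr
  set d1 : ℝ → ℝ := fun δ => d δ - δ / (2 * c) with hd1
  have bd1 : d1 =O[l] (fun δ => δ ^ 2) := by
    -- This expression equals d - δ/(2c), because δ/(2k) · (1 + d/c) = δ/(2c).
    have h1 : (fun δ => e δ * (k δ)⁻¹ - (1 / (2 * c)) * (δ * d δ * (k δ)⁻¹)) =O[l]
        (fun δ => δ ^ 2) := by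
      refine Asymptotics.IsBigO.sub ?_ (Asymptotics.IsBigO.const_mul_left ?_ _)
      · simpa using (be.trans o21).mul bk
      · simpa [pow_two] using ((Asymptotics.isBigO_refl (fun δ : ℝ => δ) l).mul bd).mul bk
    refine h1.congr' ?_ Filter.EventuallyEq.rfl
    filter_upwards [hev] with δ hδ
    have hk0 : 0 < k δ := waveNumber_pos hδ hj
    have hd' : d δ = k δ - c := rfl
    simp only [he, hd1]
    field_simp
    rw [hd']
    ring
  have bd2 : (fun δ => d1 δ + δ ^ 2 / (4 * c ^ 3)) =O[l] (fun δ => δ ^ 3) := by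
    -- Substituting d = d1 + δ/(2c) in the previous identity isolates -δ²/(4c²k), and replacing k by
    -- c there leaves the last, cubic term.
    have h1 : (fun δ => e δ * (k δ)⁻¹ - (1 / (2 * c)) * (δ * (d1 δ * (k δ)⁻¹)) +
        (1 / (4 * c ^ 3)) * (δ * δ * (d δ * (k δ)⁻¹))) =O[l] (fun δ => δ ^ 3) := by
      refine Asymptotics.IsBigO.add (Asymptotics.IsBigO.sub ?_
        (Asymptotics.IsBigO.const_mul_left ?_ _)) (Asymptotics.IsBigO.const_mul_left ?_ _)
      · simpa using be.mul bk
      · refine ((Asymptotics.isBigO_refl (fun δ : ℝ => δ) l).mul (bd1.mul bk)).congr_right ?_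
        intro δ; ring
      · refine (((Asymptotics.isBigO_refl (fun δ : ℝ => δ) l).mul
          (Asymptotics.isBigO_refl (fun δ : ℝ => δ) l)).mul (bd.mul bk)).congr_right ?_
        intro δ; ring
    refine h1.congr' ?_ Filter.EventuallyEq.rfl
    filter_upwards [hev] with δ hδ
    have hk0 : 0 < k δ := waveNumber_pos hδ hj
    have hd' : d δ = k δ - c := rfl
    simp only [he, hd1]
    field_simp
    rw [hd']
    ring
  have bl : (fun δ => lam δ - k δ) =O[l] (fun δ => δ) := by
    refine Asymptotics.IsBigO.of_bound 1 ?_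
    filter_upwards [hev] with δ hδ
    have h1 := waveNumber_le_eigenvalueSeq δ j
    have h2 := eigenvalueSeq_le hδ hj
    rw [Real.norm_eq_abs, Real.norm_eq_abs, abs_of_nonneg hδ, one_mul, abs_le]
    constructor <;> simp only [hlam, hk] <;> linarith
  have bs : (fun δ => (lam δ + k δ)⁻¹) =O[l] (fun _ => (1 : ℝ)) := by
    refine Asymptotics.IsBigO.of_bound c⁻¹ ?_
    filter_upwards [hev] with δ hδ
    have h2 := le_waveNumber hδ hj
    have h3 := eigenvalueSeq_pos hδ hj
    have h4 := waveNumber_pos hδ hj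
    have h5 : 0 ≤ (lam δ + k δ)⁻¹ := inv_nonneg.2 (add_pos h3 h4).le
    rw [Real.norm_eq_abs, abs_of_nonneg h5, norm_one, mul_one]
    exact inv_anti₀ hc0 (h2.trans (by simp only [hlam, hk]; linarith))
  have bl2 : (fun δ => lam δ - k δ - δ ^ 2 / (2 * c)) =O[l] (fun δ => δ ^ 3) := by
    -- From λ - k = δ²/(λ + k), the error is -(δ²/(2c)) (λ + k - 2c)/(λ + k), with λ + k - 2c = (λ -
    -- k) + 2d of first order.
    have h1 : (fun δ => (-1 / (2 * c)) * (δ * δ * (((lam δ - k δ) + 2 * d δ) * (lam δ + k δ)⁻¹)))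
        =O[l] (fun δ => δ ^ 3) := by
      refine Asymptotics.IsBigO.const_mul_left ?_ _
      refine (((Asymptotics.isBigO_refl (fun δ : ℝ => δ) l).mul
        (Asymptotics.isBigO_refl (fun δ : ℝ => δ) l)).mul
        ((bl.add (bd.const_mul_left 2)).mul bs)).congr_right ?_
      intro δ; ring
    refine h1.congr' ?_ Filter.EventuallyEq.rfl
    filter_upwards [hev] with δ hδ
    have h3 : 0 < lam δ := eigenvalueSeq_pos hδ hj
    have h4 : 0 < k δ := waveNumber_pos hδ hj
    have h5 : lam δ ^ 2 = k δ ^ 2 + δ ^ 2 := eigenvalueSeq_sq δ j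
    have hd' : d δ = k δ - c := rfl
    have h6 : lam δ + k δ ≠ 0 := by positivity
    rw [hd']
    field_simp
    linear_combination (-2 * c) * h5
  refine (bd2.add bl2).congr_left fun δ => ?_
  have hd' : d δ = k δ - c := rfl
  have e1 : 2 / ((2 * (j : ℝ) - 1) * Real.pi) = 1 / (2 * c) := by
    rw [hc]; field_simp; ring
  have e2 : -16 / ((2 * (j : ℝ) - 1) ^ 3 * Real.pi ^ 3) = -1 / (4 * c ^ 3) := by
    rw [hc]; field_simp; ring
  rw [e1, e2]
  simp only [hd1, hd']
  ring

/-! ### The eigenvalue equation as a linear system -/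

/-- The coefficient matrix `i μ (σ · x) - δ B` of the eigenvalue equation `f' = M f`, where
`B = swapMat x`. -/
def genMat (x : EuclideanSpace ℝ (Fin 2)) (δ : ℝ) (μ : ℝ) : Matrix (Fin 2) (Fin 2) ℂ :=
  (Complex.I * μ) • pauliDot x - (δ : ℂ) • swapMat x

theorem matMul_sub (A B : Matrix (Fin 2) (Fin 2) ℂ) (f : L2) :
    matMul (A - B) f = matMul A f - matMul B f := by
  refine Lp.ext ?_
  filter_upwards [coeFn_matMul (A - B) f, coeFn_matMul A f, coeFn_matMul B f,
    Lp.coeFn_sub (matMul A f) (matMul B f)] with t h1 h2 h3 h4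
  rw [h1, h4, Pi.sub_apply, h2, h3, matC_sub_apply]

theorem mem_eigenspace_iff {x : EuclideanSpace ℝ (Fin 2)} (hx : ‖x‖ = 1) (δ μ : ℝ) (f : L2) :
    f ∈ eigenspace (transverseOp x δ) (μ : ℂ) ↔
      f ∈ transverseDomain x ∧ HasWeakDeriv f (matMul (genMat x δ μ) f) := by
  have hI := Complex.I_mul_I
  constructor
  · rintro ⟨h, e⟩
    refine ⟨h, ?_⟩
    have hd := hasWeakDeriv_domDeriv ⟨f, h⟩
    set g := domDeriv x ⟨f, h⟩ with hg
    have e' : (-Complex.I) • matMul (pauliDot x) g + (δ : ℂ) • matMul pauli3 f = (μ : ℂ) • f :=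
      (transverseOp_mk δ h hd).symm.trans e
    have e2 := congrArg (fun w => Complex.I • matMul (pauliDot x) w) e'
    simp only [map_add, map_smul, ← matMul_mul, pauliDot_mul_self hx, matMul_one,
      pauliDot_mul_pauli3, matMul_smul, smul_add, smul_smul] at e2
    have e3 : g = matMul (genMat x δ μ) f := by
      rw [genMat, matMul_sub, matMul_smul, matMul_smul, ← e2,
        show Complex.I * -Complex.I = 1 by linear_combination -hI,
        show Complex.I * ((δ : ℂ) * -Complex.I) = δ by linear_combination -(δ : ℂ) * hI, one_smul,
        add_sub_cancel_right]
    rw [← e3]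
    exact hd
  · rintro ⟨h, hd⟩
    refine ⟨h, (transverseOp_mk δ h hd).trans ?_⟩
    rw [genMat, matMul_sub, matMul_smul, matMul_smul, map_sub, map_smul, map_smul, ← matMul_mul,
      ← matMul_mul, pauliDot_mul_self hx, pauliDot_mul_swapMat hx, matMul_one, matMul_smul,
      smul_sub, smul_smul, smul_smul, smul_smul,
      show -Complex.I * (Complex.I * (μ : ℂ)) = μ by linear_combination -(μ : ℂ) * hI,
      show -Complex.I * (δ : ℂ) * Complex.I = δ by linear_combination -(δ : ℂ) * hI,
      sub_add_cancel]

/-- The inequality is strict because f' ≠ 0 in the norm identity. It leaves only oscillating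
solutions, with real k > 0. -/
theorem sq_lt_sq_of_mem_eigenspace {x : EuclideanSpace ℝ (Fin 2)} (hx : ‖x‖ = 1) {δ : ℝ}
    (hδ : 0 ≤ δ) {μ : ℝ} {f : L2} (hf : f ∈ eigenspace (transverseOp x δ) (μ : ℂ)) (h0 : f ≠ 0) :
    δ ^ 2 < μ ^ 2 := by
  obtain ⟨h, e⟩ := hf
  obtain ⟨u, hu⟩ := (hasWeakDeriv_domDeriv ⟨f, h⟩).exists_isContRep
  have key := norm_sq_transverseOp hx δ ⟨f, h⟩ hu
  have e' : ‖transverseOp x δ ⟨f, h⟩‖ ^ 2 = μ ^ 2 * ‖f‖ ^ 2 := by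
    rw [e, norm_smul, mul_pow, Complex.norm_real, Real.norm_eq_abs, sq_abs]
  have hd : domDeriv x ⟨f, h⟩ ≠ 0 := fun hz =>
    h0 (congrArg Subtype.val (eq_zero_of_domDeriv_eq_zero hx hz))
  have h1 : 0 < ‖domDeriv x ⟨f, h⟩‖ ^ 2 := by
    have := norm_pos_iff.2 hd
    positivity
  have h2 : 0 ≤ δ * (‖u 1‖ ^ 2 + ‖u (-1)‖ ^ 2) := by positivity
  have h3 : 0 < ‖f‖ ^ 2 := by
    have := norm_pos_iff.2 h0
    positivity
  have h4 : ‖transverseOp x δ ⟨f, h⟩‖ ^ 2 = ‖domDeriv x ⟨f, h⟩‖ ^ 2 + δ ^ 2 * ‖f‖ ^ 2 +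
    δ * (‖u 1‖ ^ 2 + ‖u (-1)‖ ^ 2) := key
  rw [e'] at h4
  refine lt_of_mul_lt_mul_right ?_ h3.le
  linarith

/-- The equation for u holds only in integrated form, so u is first identified with a C¹ function W,
to which Grönwall uniqueness applies. -/
theorem eqOn_of_linear_ode (L : C2 →L[ℂ] C2) {g : L2} {u e : ℝ → C2}
    (hu : ContinuousOn u (Set.Icc (-1) 1))
    (hint : ∀ t ∈ Set.Icc (-1 : ℝ) 1, u t = u (-1) + prim g t) (hg : g =ᵐ[vol] fun t => L (u t))
    (he : ∀ t, HasDerivAt e (L (e t)) t) (h0 : u (-1) = e (-1)) :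
    Set.EqOn u e (Set.Icc (-1) 1) := by
  have hle : (-1 : ℝ) ≤ 1 := by norm_num
  set U : ℝ → C2 := Set.IccExtend hle ((Set.Icc (-1 : ℝ) 1).domRestrict u) with hU
  have hUc : Continuous U := hu.domRestrict.Icc_extend'
  have hUu : ∀ t ∈ Set.Icc (-1 : ℝ) 1, U t = u t := fun t ht => by
    rw [hU, Set.IccExtend_of_mem _ _ ht]; rfl
  have hLc : Continuous fun t => L (U t) := L.continuous.comp hUc
  set W : ℝ → C2 := fun t => u (-1) + ∫ s in (-1)..t, L (U s) with hW
  have hWd : ∀ t, HasDerivAt W (L (U t)) t := fun t =>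
    (intervalIntegral.integral_hasDerivAt_right (hLc.intervalIntegrable _ _)
      hLc.stronglyMeasurable.stronglyMeasurableAtFilter hLc.continuousAt).const_add _
  have hWu : ∀ t ∈ Set.Icc (-1 : ℝ) 1, W t = u t := fun t ht => by
    have hgU : g =ᵐ[vol] fun t => L (U t) := by
      filter_upwards [hg, ae_restrict_mem measurableSet_Ioo] with s h1 hs
      rw [h1, hUu s ⟨hs.1.le, hs.2.le⟩]
    rw [hint t ht, prim_congr hgU, prim_eq_intervalIntegral _ ht]
  have key : Set.EqOn W e (Set.Icc (-1) 1) := by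
    refine ODE_solution_unique_of_mem_Icc_right (v := fun _ y => L y) (s := fun _ => Set.univ)
      (K := ‖L‖₊) (fun t _ => L.lipschitz.lipschitzOnWith) ?_ ?_ (fun _ _ => Set.mem_univ _) ?_ ?_
      (fun _ _ => Set.mem_univ _) ?_
    · exact fun t _ => (hWd t).continuousAt.continuousWithinAt
    · intro t ht
      have ht' : t ∈ Set.Icc (-1 : ℝ) 1 := ⟨ht.1, ht.2.le⟩
      have := (hWd t).hasDerivWithinAt (s := Set.Ici t)
      rwa [hUu t ht', ← hWu t ht'] at this
    · exact fun t _ => (he t).continuousAt.continuousWithinAt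
    · exact fun t _ => (he t).hasDerivWithinAt
    · rw [hWu (-1) (by simp), h0]
  intro t ht
  rw [← hWu t ht]
  exact key ht

/-! ### The eigenfunctions -/

/-- The vector `(1, -i(x₁ + i x₂))`. -/
def vMinus (x : EuclideanSpace ℝ (Fin 2)) : C2 := !₂[(1 : ℂ), -(Complex.I * toC x)]

/-- The vector `(1, i(x₁ + i x₂))`. -/
def vPlus (x : EuclideanSpace ℝ (Fin 2)) : C2 := !₂[(1 : ℂ), Complex.I * toC x]

theorem c2_ext {v w : C2} (h0 : v 0 = w 0) (h1 : v 1 = w 1) : v = w := by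
  ext i
  fin_cases i
  · exact h0
  · exact h1

theorem swapMat_vMinus {x : EuclideanSpace ℝ (Fin 2)} (hx : ‖x‖ = 1) :
    matC (swapMat x) (vMinus x) = -vMinus x := by
  have h := toC_mul_conj hx
  have hI := Complex.I_mul_I
  refine c2_ext ?_ ?_
  · rw [matC_apply_zero]
    simp only [swapMat, vMinus, Matrix.of_apply, Matrix.cons_val, PiLp.neg_apply]
    linear_combination Complex.I * Complex.I * h + hI
  · rw [matC_apply_one]
    simp [swapMat, vMinus]

theorem swapMat_vPlus {x : EuclideanSpace ℝ (Fin 2)} (hx : ‖x‖ = 1) :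
    matC (swapMat x) (vPlus x) = vPlus x := by
  have h := toC_mul_conj hx
  have hI := Complex.I_mul_I
  refine c2_ext ?_ ?_
  · rw [matC_apply_zero]
    simp only [swapMat, vPlus, Matrix.of_apply, Matrix.cons_val]
    linear_combination -Complex.I * Complex.I * h - hI
  · rw [matC_apply_one]
    simp [swapMat, vPlus]

theorem pauliDot_vMinus {x : EuclideanSpace ℝ (Fin 2)} (hx : ‖x‖ = 1) :
    matC (pauliDot x) (vMinus x) = (-Complex.I) • vPlus x := by
  have h := toC_mul_conj hx
  have hI := Complex.I_mul_I
  rw [pauliDot_eq]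
  refine c2_ext ?_ ?_
  · rw [matC_apply_zero]
    simp only [vMinus, vPlus, Matrix.of_apply, Matrix.cons_val, PiLp.smul_apply, smul_eq_mul]
    linear_combination -Complex.I * h
  · rw [matC_apply_one]
    simp only [vMinus, vPlus, Matrix.of_apply, Matrix.cons_val, PiLp.smul_apply, smul_eq_mul]
    linear_combination toC x * hI

theorem pauliDot_vPlus {x : EuclideanSpace ℝ (Fin 2)} (hx : ‖x‖ = 1) :
    matC (pauliDot x) (vPlus x) = Complex.I • vMinus x := by
  have h := toC_mul_conj hx
  have hI := Complex.I_mul_I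
  rw [pauliDot_eq]
  refine c2_ext ?_ ?_
  · rw [matC_apply_zero]
    simp only [vMinus, vPlus, Matrix.of_apply, Matrix.cons_val, PiLp.smul_apply, smul_eq_mul]
    linear_combination Complex.I * h
  · rw [matC_apply_one]
    simp only [vMinus, vPlus, Matrix.of_apply, Matrix.cons_val, PiLp.smul_apply, smul_eq_mul]
    linear_combination toC x * hI

/-- In the basis v₋, v₊ the system matrix M has the real columns (δ, μ) and (-μ, -δ), so M² = -(μ² -
δ²). Hence exp(sM)v₋ = cos(ks)v₋ + (sin(ks)/k)Mv₋, the formula behind `eigenFun`. -/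
theorem genMat_vMinus {x : EuclideanSpace ℝ (Fin 2)} (hx : ‖x‖ = 1) (δ μ : ℝ) :
    matC (genMat x δ μ) (vMinus x) = (δ : ℂ) • vMinus x + (μ : ℂ) • vPlus x := by
  rw [genMat, matC_sub_apply, matC_smul_apply, matC_smul_apply, pauliDot_vMinus hx,
    swapMat_vMinus hx, smul_smul,
    show Complex.I * (μ : ℂ) * -Complex.I = μ by linear_combination -(μ : ℂ) * Complex.I_mul_I,
    smul_neg, sub_neg_eq_add, add_comm]

theorem genMat_vPlus {x : EuclideanSpace ℝ (Fin 2)} (hx : ‖x‖ = 1) (δ μ : ℝ) :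
    matC (genMat x δ μ) (vPlus x) = -(μ : ℂ) • vMinus x - (δ : ℂ) • vPlus x := by
  rw [genMat, matC_sub_apply, matC_smul_apply, matC_smul_apply, pauliDot_vPlus hx,
    swapMat_vPlus hx, smul_smul,
    show Complex.I * (μ : ℂ) * Complex.I = -μ by linear_combination (μ : ℂ) * Complex.I_mul_I]

/-- The solution of the eigenvalue equation with value `vMinus x` at `-1`, for `k² = μ² - δ²`. -/
def eigenFun (x : EuclideanSpace ℝ (Fin 2)) (δ μ k : ℝ) (t : ℝ) : C2 :=
  ((Real.cos (k * (t + 1)) + δ / k * Real.sin (k * (t + 1)) : ℝ) : ℂ) • vMinus x +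
    ((μ / k * Real.sin (k * (t + 1)) : ℝ) : ℂ) • vPlus x

theorem hasDerivAt_eigenFun {x : EuclideanSpace ℝ (Fin 2)} (hx : ‖x‖ = 1) {δ μ k : ℝ}
    (hk : k ≠ 0) (hkμ : k ^ 2 = μ ^ 2 - δ ^ 2) (t : ℝ) :
    HasDerivAt (eigenFun x δ μ k) (matC (genMat x δ μ) (eigenFun x δ μ k t)) t := by
  have hs : HasDerivAt (fun t : ℝ => k * (t + 1)) k t := by
    simpa using ((hasDerivAt_id t).add_const 1).const_mul k
  have hcos := hs.cos
  have hsin := hs.sin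
  have h1 := (hcos.add (hsin.const_mul (δ / k))).ofReal_comp.smul_const (vMinus x)
  have h2 := (hsin.const_mul (μ / k)).ofReal_comp.smul_const (vPlus x)
  have h3 := h1.add h2
  refine h3.congr_deriv ?_
  rw [eigenFun, map_add, map_smul, map_smul, genMat_vMinus hx, genMat_vPlus hx]
  have hk' : (k : ℂ) ≠ 0 := by exact_mod_cast hk
  have hkμ' : (k : ℂ) ^ 2 = μ ^ 2 - δ ^ 2 := by exact_mod_cast hkμ
  match_scalars
  · field_simp
    linear_combination (-Complex.sin ((k : ℂ) * (t + 1))) * hkμ'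
  · field_simp
    ring

theorem eigenFun_neg_one (x : EuclideanSpace ℝ (Fin 2)) (δ μ k : ℝ) :
    eigenFun x δ μ k (-1) = vMinus x := by
  simp [eigenFun]

theorem continuous_eigenFun (x : EuclideanSpace ℝ (Fin 2)) (δ μ k : ℝ) :
    Continuous (eigenFun x δ μ k) := by
  unfold eigenFun
  fun_prop

theorem memLp_eigenFun (x : EuclideanSpace ℝ (Fin 2)) (δ μ k : ℝ) :
    MemLp (eigenFun x δ μ k) 2 vol :=
  memLp_of_continuous (continuous_eigenFun x δ μ k) 2

/-- The function `eigenFun` as an element of `L²`. -/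
def eigenVec (x : EuclideanSpace ℝ (Fin 2)) (δ μ k : ℝ) : L2 := (memLp_eigenFun x δ μ k).toLp

theorem coeFn_eigenVec (x : EuclideanSpace ℝ (Fin 2)) (δ μ k : ℝ) :
    eigenVec x δ μ k =ᵐ[vol] eigenFun x δ μ k := MemLp.coeFn_toLp _

theorem isContRep_eigenVec (x : EuclideanSpace ℝ (Fin 2)) (δ μ k : ℝ) :
    IsContRep (eigenVec x δ μ k) (eigenFun x δ μ k) :=
  ⟨(continuous_eigenFun x δ μ k).continuousOn, coeFn_eigenVec x δ μ k⟩

theorem isContRep_smul {f : L2} {u : ℝ → C2} (h : IsContRep f u) (c : ℂ) :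
    IsContRep (c • f) (fun t => c • u t) := by
  refine ⟨h.1.const_smul c, ?_⟩
  filter_upwards [Lp.coeFn_smul c f, h.2] with t h1 h2
  rw [h1, Pi.smul_apply, h2]

theorem vMinus_ne_zero (x : EuclideanSpace ℝ (Fin 2)) : vMinus x ≠ 0 := fun h => by
  have := congrArg (fun v : C2 => v 0) h
  simp [vMinus] at this

theorem eigenVec_ne_zero (x : EuclideanSpace ℝ (Fin 2)) (δ μ k : ℝ) : eigenVec x δ μ k ≠ 0 := by
  intro h
  have h1 := isContRep_eigenVec x δ μ k
  rw [h] at h1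
  have h2 : IsContRep 0 (fun _ => 0) := ⟨continuousOn_const, Lp.coeFn_zero _ _ _⟩
  have h3 := h1.eqOn h2 (by simp : (-1 : ℝ) ∈ Set.Icc (-1 : ℝ) 1)
  rw [eigenFun_neg_one] at h3
  exact vMinus_ne_zero x h3

theorem hasWeakDeriv_eigenVec {x : EuclideanSpace ℝ (Fin 2)} (hx : ‖x‖ = 1) {δ μ k : ℝ}
    (hk : k ≠ 0) (hkμ : k ^ 2 = μ ^ 2 - δ ^ 2) :
    HasWeakDeriv (eigenVec x δ μ k) (matMul (genMat x δ μ) (eigenVec x δ μ k)) := by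
  refine hasWeakDeriv_of_ae_eq (c := eigenFun x δ μ k (-1)) ?_
  have hae : matMul (genMat x δ μ) (eigenVec x δ μ k) =ᵐ[vol]
      fun t => matC (genMat x δ μ) (eigenFun x δ μ k t) :=
    ((isContRep_eigenVec x δ μ k).matMul _).2
  filter_upwards [coeFn_eigenVec x δ μ k, ae_restrict_mem measurableSet_Ioo] with t h1 ht
  rw [h1, prim_congr hae, prim_eq_sub_of_hasDerivAt (hasDerivAt_eigenFun hx hk hkμ)
    ((matC _).continuous.comp (continuous_eigenFun x δ μ k)) ⟨ht.1.le, ht.2.le⟩]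
  abel

/-- The condition at 1 fails exactly by the v₋ component of the solution there, which is the secular
function. -/
theorem swapMat_eigenFun_one {x : EuclideanSpace ℝ (Fin 2)} (hx : ‖x‖ = 1) (δ μ k : ℝ) :
    matC (swapMat x) (eigenFun x δ μ k 1) = eigenFun x δ μ k 1 -
      (2 : ℂ) • ((Real.cos (2 * k) + δ / k * Real.sin (2 * k) : ℝ) : ℂ) • vMinus x := by
  rw [eigenFun, map_add, map_smul, map_smul, swapMat_vMinus hx, swapMat_vPlus hx,
    show k * ((1 : ℝ) + 1) = 2 * k by ring]
  module

theorem eigenVec_mem_eigenspace {x : EuclideanSpace ℝ (Fin 2)} (hx : ‖x‖ = 1) {δ μ k : ℝ}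
    (hk : k ≠ 0) (hkμ : k ^ 2 = μ ^ 2 - δ ^ 2)
    (hsec : Real.cos (2 * k) + δ / k * Real.sin (2 * k) = 0) :
    eigenVec x δ μ k ∈ eigenspace (transverseOp x δ) (μ : ℂ) := by
  have hd := hasWeakDeriv_eigenVec hx hk hkμ
  refine (mem_eigenspace_iff hx δ μ _).2 ⟨⟨⟨_, hd⟩, _, isContRep_eigenVec x δ μ k,
    (boundaryCond_iff hx).2 ⟨?_, ?_⟩⟩, hd⟩
  · rw [swapMat_eigenFun_one hx, hsec]; simp
  · rw [eigenFun_neg_one, swapMat_vMinus hx]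

/-- The condition at -1 puts u(-1) on the line of v₋, and uniqueness for the system does the rest.
The second clause is the condition at 1. -/
theorem exists_smul_eigenVec {x : EuclideanSpace ℝ (Fin 2)} (hx : ‖x‖ = 1) {δ μ k : ℝ}
    (hk : k ≠ 0) (hkμ : k ^ 2 = μ ^ 2 - δ ^ 2) {f : L2}
    (hf : f ∈ eigenspace (transverseOp x δ) (μ : ℂ)) :
    ∃ c : ℂ, f = c • eigenVec x δ μ k ∧
      c * ((Real.cos (2 * k) + δ / k * Real.sin (2 * k) : ℝ) : ℂ) = 0 := by
  obtain ⟨hdom, hd⟩ := (mem_eigenspace_iff hx δ μ f).1 hf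
  obtain ⟨u, hu⟩ := hd.exists_isContRep
  have hbc := boundaryCond_of_mem hdom hu
  obtain ⟨b1, b2⟩ := (boundaryCond_iff hx).1 hbc
  set c : ℂ := u (-1) 0 with hc
  have h0 : u (-1) = c • vMinus x := by
    refine c2_ext ?_ ?_
    · simp [vMinus, hc]
    · rw [hbc.2]; simp [vMinus, hc]; ring
  have heq : Set.EqOn u (fun t => c • eigenFun x δ μ k t) (Set.Icc (-1) 1) := by
    refine eqOn_of_linear_ode (matC (genMat x δ μ)) hu.1 (fun t ht => hd.eq_add_prim hu ht)
      (hu.matMul _).2 (fun t => ?_) (by rw [eigenFun_neg_one, h0])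
    rw [map_smul]
    exact (hasDerivAt_eigenFun hx hk hkμ t).const_smul c
  refine ⟨c, ?_, ?_⟩
  · refine Lp.ext ?_
    filter_upwards [hu.2, (isContRep_smul (isContRep_eigenVec x δ μ k) c).2,
      ae_restrict_mem measurableSet_Ioo] with t h1 h2 ht
    rw [h1, h2, heq ⟨ht.1.le, ht.2.le⟩]
  · have e1 := heq (by simp : (1 : ℝ) ∈ Set.Icc (-1 : ℝ) 1)
    rw [e1, map_smul, swapMat_eigenFun_one hx, smul_sub, sub_eq_self, smul_smul, smul_smul] at b1
    have := (smul_eq_zero.1 b1).resolve_right (vMinus_ne_zero x)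
    linear_combination this / 2

/-- Eigenvalues are simple and the sequence is strictly increasing, so both multiplicities are 1 or
both are 0. -/
theorem isPosEigenvalueSeq {x : EuclideanSpace ℝ (Fin 2)} (hx : ‖x‖ = 1) {δ : ℝ} (hδ : 0 ≤ δ) :
    IsPosEigenvalueSeq (transverseOp x δ) (eigenvalueSeq δ) := by
  refine ⟨fun i hi j _ hij => ?_, fun j hj => eigenvalueSeq_pos hδ hj, fun μ hμ => ?_⟩
  · rcases hij.eq_or_lt with h | h
    · rw [h]
    · exact (eigenvalueSeq_lt hδ hi h).le
  by_cases hex : ∃ j : ℕ, 1 ≤ j ∧ eigenvalueSeq δ j = μ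
  · obtain ⟨j, hj, rfl⟩ := hex
    have hk := waveNumber_pos hδ hj
    have hkμ : waveNumber δ j ^ 2 = eigenvalueSeq δ j ^ 2 - δ ^ 2 := by
      rw [eigenvalueSeq_sq]; ring
    have hsec := (secular_iff hδ hk).2 ⟨j, hj, rfl⟩
    have hspan : eigenspace (transverseOp x δ) (eigenvalueSeq δ j : ℂ) =
        Submodule.span ℂ {eigenVec x δ (eigenvalueSeq δ j) (waveNumber δ j)} := by
      refine le_antisymm (fun f hf => ?_) ?_
      · obtain ⟨c, hc, -⟩ := exists_smul_eigenVec hx hk.ne' hkμ hf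
        exact Submodule.mem_span_singleton.2 ⟨c, hc.symm⟩
      · rw [Submodule.span_singleton_le_iff_mem]
        exact eigenVec_mem_eigenspace hx hk.ne' hkμ hsec
    have hcard : Cardinal.mk {i : ℕ // 1 ≤ i ∧ eigenvalueSeq δ i = eigenvalueSeq δ j} = 1 := by
      rw [Cardinal.eq_one_iff_unique]
      refine ⟨⟨fun a b => ?_⟩, ⟨⟨j, hj, rfl⟩⟩⟩
      have huniq : ∀ a : {i : ℕ // 1 ≤ i ∧ eigenvalueSeq δ i = eigenvalueSeq δ j}, a.1 = j := by
        rintro ⟨i, hi, e⟩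
        rcases lt_trichotomy i j with h | h | h
        · exact absurd e (eigenvalueSeq_lt hδ hi h).ne
        · exact h
        · exact absurd e (eigenvalueSeq_lt hδ hj h).ne'
      exact Subtype.ext ((huniq a).trans (huniq b).symm)
    rw [hcard, hspan]
    rw [← (LinearEquiv.toSpanNonzeroSingleton ℂ L2 _ (eigenVec_ne_zero x δ _ _)).rank_eq,
      Module.rank_self]
  · have hbot : eigenspace (transverseOp x δ) (μ : ℂ) = ⊥ := by
      rw [Submodule.eq_bot_iff]
      intro f hf
      by_contra h0
      have hlt := sq_lt_sq_of_mem_eigenspace hx hδ hf h0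
      have hpos : 0 < μ ^ 2 - δ ^ 2 := by linarith
      have hk : 0 < Real.sqrt (μ ^ 2 - δ ^ 2) := Real.sqrt_pos.2 hpos
      have hkμ : Real.sqrt (μ ^ 2 - δ ^ 2) ^ 2 = μ ^ 2 - δ ^ 2 := Real.sq_sqrt hpos.le
      obtain ⟨c, hc, hsec⟩ := exists_smul_eigenVec hx hk.ne' hkμ hf
      have hc0 : c ≠ 0 := fun h => h0 (by rw [hc, h, zero_smul])
      have hsec' := Complex.ofReal_eq_zero.1 ((mul_eq_zero.1 hsec).resolve_left hc0)
      obtain ⟨j, hj, e⟩ := (secular_iff hδ hk).1 hsec'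
      exact hex ⟨j, hj, (eigenvalueSeq_eq_iff hδ hμ hk hkμ hj).2 e⟩
    have hempty : IsEmpty {i : ℕ // 1 ≤ i ∧ eigenvalueSeq δ i = μ} :=
      ⟨fun a => hex ⟨a.1, a.2⟩⟩
    rw [hbot, rank_bot, Cardinal.mk_eq_zero]

/-! ### Charge conjugation -/

theorem chargeConjC2_apply_zero (v : C2) : chargeConjC2 v 0 = (starRingEnd ℂ) (v 1) := by
  show matC pauli1 (conjC2 v) 0 = _
  rw [matC_apply_zero]
  simp [pauli1, conjC2]

theorem chargeConjC2_apply_one (v : C2) : chargeConjC2 v 1 = (starRingEnd ℂ) (v 0) := by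
  show matC pauli1 (conjC2 v) 1 = _
  rw [matC_apply_one]
  simp [pauli1, conjC2]

theorem chargeConjC2_chargeConjC2 (v : C2) : chargeConjC2 (chargeConjC2 v) = v := by
  refine c2_ext ?_ ?_
  · rw [chargeConjC2_apply_zero, chargeConjC2_apply_one, Complex.conj_conj]
  · rw [chargeConjC2_apply_one, chargeConjC2_apply_zero, Complex.conj_conj]

theorem norm_chargeConjC2 (v : C2) : ‖chargeConjC2 v‖ = ‖v‖ := by
  rw [EuclideanSpace.norm_eq, EuclideanSpace.norm_eq, Fin.sum_univ_two, Fin.sum_univ_two,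
    chargeConjC2_apply_zero, chargeConjC2_apply_one, RCLike.norm_conj, RCLike.norm_conj, add_comm]

theorem coeFn_chargeConj (f : L2) : chargeConj f =ᵐ[vol] fun t => chargeConjC2 (f t) :=
  ContinuousLinearMap.coeFn_compLpL _ _

theorem chargeConj_chargeConj (f : L2) : chargeConj (chargeConj f) = f := by
  refine Lp.ext ?_
  filter_upwards [coeFn_chargeConj (chargeConj f), coeFn_chargeConj f] with t h1 h2
  rw [h1, h2, chargeConjC2_chargeConjC2]

theorem norm_chargeConj (f : L2) : ‖chargeConj f‖ = ‖f‖ := by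
  rw [Lp.norm_def, Lp.norm_def]
  congr 1
  refine eLpNorm_congr_norm_ae ?_
  filter_upwards [coeFn_chargeConj f] with t ht
  rw [ht, norm_chargeConjC2]

theorem chargeConjC2_swapMat (x : EuclideanSpace ℝ (Fin 2)) (v : C2) :
    chargeConjC2 (matC (swapMat x) v) = matC (swapMat x) (chargeConjC2 v) := by
  refine c2_ext ?_ ?_
  · rw [chargeConjC2_apply_zero, matC_apply_one, matC_apply_zero, chargeConjC2_apply_zero,
      chargeConjC2_apply_one]
    simp [swapMat]
  · rw [chargeConjC2_apply_one, matC_apply_one, matC_apply_zero, chargeConjC2_apply_zero,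
      chargeConjC2_apply_one]
    simp [swapMat]

theorem chargeConjC2_pauliDot (x : EuclideanSpace ℝ (Fin 2)) (v : C2) :
    chargeConjC2 (matC (pauliDot x) v) = matC (pauliDot x) (chargeConjC2 v) := by
  rw [pauliDot_eq]
  refine c2_ext ?_ ?_
  · rw [chargeConjC2_apply_zero, matC_apply_one, matC_apply_zero, chargeConjC2_apply_zero,
      chargeConjC2_apply_one]
    simp
  · rw [chargeConjC2_apply_one, matC_apply_one, matC_apply_zero, chargeConjC2_apply_zero,
      chargeConjC2_apply_one]
    simp

/-- Antilinearity conjugates the coefficient iμ, while δ is real and both matrices commute with the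
conjugation. -/
theorem chargeConjC2_genMat (x : EuclideanSpace ℝ (Fin 2)) (δ μ : ℝ) (v : C2) :
    chargeConjC2 (matC (genMat x δ μ) v) = matC (genMat x δ (-μ)) (chargeConjC2 v) := by
  rw [genMat, genMat, matC_sub_apply, matC_smul_apply, matC_smul_apply, matC_sub_apply,
    matC_smul_apply, matC_smul_apply, map_sub, map_smulₛₗ, map_smulₛₗ, chargeConjC2_swapMat,
    chargeConjC2_pauliDot]
  simp

/-- The charge conjugation on `ℂ²` as a real linear map. -/
def chargeConjReal : C2 →L[ℝ] C2 where
  toFun := chargeConjC2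
  map_add' := map_add chargeConjC2
  map_smul' c v := by
    have h : ∀ w : C2, c • w = (c : ℂ) • w := fun w => (Complex.coe_smul c w).symm
    rw [RingHom.id_apply, h, h, map_smulₛₗ, Complex.conj_ofReal]
  cont := chargeConjC2.continuous

theorem chargeConj_mem_eigenspace {x : EuclideanSpace ℝ (Fin 2)} (hx : ‖x‖ = 1) {δ μ : ℝ} {f : L2}
    (hf : f ∈ eigenspace (transverseOp x δ) (μ : ℂ)) :
    chargeConj f ∈ eigenspace (transverseOp x δ) (((-μ : ℝ)) : ℂ) := by
  obtain ⟨hdom, hd⟩ := (mem_eigenspace_iff hx δ μ f).1 hf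
  obtain ⟨u, hu⟩ := hd.exists_isContRep
  obtain ⟨b1, b2⟩ := (boundaryCond_iff hx).1 (boundaryCond_of_mem hdom hu)
  have hd' : HasWeakDeriv (chargeConj f) (matMul (genMat x δ (-μ)) (chargeConj f)) := by
    refine hd.comp_realCLM chargeConjReal (coeFn_chargeConj f) ?_
    filter_upwards [coeFn_matMul (genMat x δ (-μ)) (chargeConj f), coeFn_chargeConj f,
      coeFn_matMul (genMat x δ μ) f] with t h1 h2 h3
    rw [h1, h2, h3]
    exact (chargeConjC2_genMat x δ μ (f t)).symm
  have hu' : IsContRep (chargeConj f) (fun t => chargeConjC2 (u t)) := by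
    refine ⟨chargeConjC2.continuous.comp_continuousOn hu.1, ?_⟩
    filter_upwards [coeFn_chargeConj f, hu.2] with t h1 h2
    rw [h1, h2]
  refine (mem_eigenspace_iff hx δ (-μ) _).2
    ⟨⟨⟨_, hd'⟩, _, hu', (boundaryCond_iff hx).2 ⟨?_, ?_⟩⟩, hd'⟩
  · rw [← chargeConjC2_swapMat, b1]
  · rw [← chargeConjC2_swapMat, b2, map_neg]

theorem supDist_chargeConj (f : L2) (g : ℝ → C2) :
    supDist (chargeConj f) (fun t => chargeConjC2 (g t)) = supDist f g := by
  refine eLpNorm_congr_norm_ae ?_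
  filter_upwards [coeFn_chargeConj f] with t ht
  rw [ht, ← map_sub, norm_chargeConjC2]

/-! ### Convergence of the eigenfunctions -/

theorem norm_sq_smul_vMinus_add_smul_vPlus {x : EuclideanSpace ℝ (Fin 2)} (hx : ‖x‖ = 1)
    (a b : ℝ) : ‖(a : ℂ) • vMinus x + (b : ℂ) • vPlus x‖ ^ 2 = 2 * (a ^ 2 + b ^ 2) := by
  have hn : ‖toC x‖ = 1 := by
    have h := congrArg norm (toC_mul_conj hx)
    rw [norm_mul, RCLike.norm_conj, norm_one] at h
    nlinarith [norm_nonneg (toC x)]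
  rw [EuclideanSpace.norm_sq_eq, Fin.sum_univ_two]
  have h0 : ((a : ℂ) • vMinus x + (b : ℂ) • vPlus x) 0 = ((a + b : ℝ) : ℂ) := by
    simp [vMinus, vPlus]
  have h1 : ((a : ℂ) • vMinus x + (b : ℂ) • vPlus x) 1 =
      ((b - a : ℝ) : ℂ) * (Complex.I * toC x) := by
    simp [vMinus, vPlus]; ring
  rw [h0, h1, norm_mul, norm_mul, Complex.norm_I, hn, Complex.norm_real, Complex.norm_real,
    Real.norm_eq_abs, Real.norm_eq_abs, mul_one, mul_one, sq_abs, sq_abs]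
  ring

theorem norm_smul_vMinus_add_smul_vPlus_le {x : EuclideanSpace ℝ (Fin 2)} (hx : ‖x‖ = 1)
    (a b : ℝ) : ‖(a : ℂ) • vMinus x + (b : ℂ) • vPlus x‖ ≤ 2 * (|a| + |b|) := by
  refine abs_le_of_sq_le_sq' ?_ (by positivity) |>.2
  rw [norm_sq_smul_vMinus_add_smul_vPlus hx, ← sq_abs a, ← sq_abs b]
  nlinarith [abs_nonneg a, abs_nonneg b, mul_nonneg (abs_nonneg a) (abs_nonneg b)]

theorem profilePlus_eq (x : EuclideanSpace ℝ (Fin 2)) {j : ℕ} (hj : 1 ≤ j) (t : ℝ) :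
    profilePlus x j t = (1 / 2 : ℂ) • eigenFun x 0 ((2 * j - 1) * Real.pi / 4)
      ((2 * j - 1) * Real.pi / 4) t := by
  have hj' : (1 : ℝ) ≤ j := by exact_mod_cast hj
  have hk : (2 * (j : ℝ) - 1) * Real.pi / 4 ≠ 0 := by
    have : (0 : ℝ) < 2 * j - 1 := by linarith
    have := Real.pi_pos
    positivity
  rw [eigenFun, div_self hk, zero_div, zero_mul, add_zero, one_mul, smul_add, smul_smul, smul_smul,
    profilePlus, vMinus, vPlus]
  push_cast
  rfl

theorem abs_cos_sub_cos_le (a b : ℝ) : |Real.cos a - Real.cos b| ≤ |a - b| := by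
  have h := (Real.lipschitzWith_cos).dist_le_mul a b
  simpa [Real.dist_eq] using h

theorem abs_sin_sub_sin_le (a b : ℝ) : |Real.sin a - Real.sin b| ≤ |a - b| := by
  have h := (Real.lipschitzWith_sin).dist_le_mul a b
  simpa [Real.dist_eq] using h

/-- Every ingredient is Lipschitz in δ because k ≥ 1/2 for all j. Each of the two coefficients moves
by at most 4δ, whence 16 = 2(4 + 4). -/
theorem norm_eigenFun_sub_le {x : EuclideanSpace ℝ (Fin 2)} (hx : ‖x‖ = 1) {δ : ℝ} (hδ : 0 ≤ δ)
    {j : ℕ} (hj : 1 ≤ j) {t : ℝ} (ht : t ∈ Set.Icc (-1 : ℝ) 1) :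
    ‖eigenFun x δ (eigenvalueSeq δ j) (waveNumber δ j) t -
      eigenFun x 0 ((2 * j - 1) * Real.pi / 4) ((2 * j - 1) * Real.pi / 4) t‖ ≤ 16 * δ := by
  have hj' : (1 : ℝ) ≤ j := by exact_mod_cast hj
  have hpi := Real.pi_gt_three
  set c : ℝ := (2 * j - 1) * Real.pi / 4 with hc
  have hc1 : 1 / 2 ≤ c := by rw [hc]; nlinarith
  have hk0 := waveNumber_pos hδ hj
  have h1 := waveNumber_sub_le hδ hj
  have h2 := le_waveNumber hδ hj
  have h3 := waveNumber_le_eigenvalueSeq δ j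
  have h4 := eigenvalueSeq_le hδ hj
  rw [← hc] at h1 h2
  set k := waveNumber δ j
  set μ := eigenvalueSeq δ j
  have hk1 : 1 / 2 ≤ k := hc1.trans h2
  have harg : |k * (t + 1) - c * (t + 1)| ≤ 2 * δ := by
    rw [← sub_mul, abs_mul, abs_of_nonneg (by linarith), abs_of_nonneg (by linarith [ht.1])]
    nlinarith [ht.1, ht.2]
  have hcos := (abs_cos_sub_cos_le (k * (t + 1)) (c * (t + 1))).trans harg
  have hsin := (abs_sin_sub_sin_le (k * (t + 1)) (c * (t + 1))).trans harg
  have hδk : |δ / k| ≤ 2 * δ := by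
    rw [abs_of_nonneg (by positivity), div_le_iff₀ hk0]; nlinarith
  have hμk : |μ / k - 1| ≤ 2 * δ := by
    have : μ / k - 1 = (μ - k) / k := by field_simp
    rw [this, abs_of_nonneg (div_nonneg (by linarith) hk0.le), div_le_iff₀ hk0]; nlinarith
  have hs := Real.abs_sin_le_one (k * (t + 1))
  have e : eigenFun x δ μ k t - eigenFun x 0 c c t =
      ((Real.cos (k * (t + 1)) - Real.cos (c * (t + 1)) +
        δ / k * Real.sin (k * (t + 1)) : ℝ) : ℂ) • vMinus x +
      (((μ / k - 1) * Real.sin (k * (t + 1)) +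
        (Real.sin (k * (t + 1)) - Real.sin (c * (t + 1))) : ℝ) : ℂ) • vPlus x := by
    have hc0 : c ≠ 0 := by linarith
    rw [eigenFun, eigenFun, div_self hc0]
    push_cast
    module
  rw [e]
  refine (norm_smul_vMinus_add_smul_vPlus_le hx _ _).trans ?_
  have i1 : |Real.cos (k * (t + 1)) - Real.cos (c * (t + 1)) + δ / k * Real.sin (k * (t + 1))| ≤
      4 * δ := by
    refine (abs_add_le _ _).trans ?_
    rw [abs_mul]
    nlinarith [abs_nonneg (δ / k), abs_nonneg (Real.sin (k * (t + 1)))]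
  have i2 : |(μ / k - 1) * Real.sin (k * (t + 1)) +
      (Real.sin (k * (t + 1)) - Real.sin (c * (t + 1)))| ≤ 4 * δ := by
    refine (abs_add_le _ _).trans ?_
    rw [abs_mul]
    nlinarith [abs_nonneg (μ / k - 1), abs_nonneg (Real.sin (k * (t + 1)))]
  linarith

theorem vol_univ : vol Set.univ = 2 := by
  rw [Measure.restrict_apply_univ, Real.volume_Ioo]
  norm_num

theorem norm_eigenFun_zero {x : EuclideanSpace ℝ (Fin 2)} (hx : ‖x‖ = 1) {c : ℝ} (hc : c ≠ 0)
    (t : ℝ) : ‖eigenFun x 0 c c t‖ = Real.sqrt 2 := by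
  rw [← sq_eq_sq₀ (norm_nonneg _) (Real.sqrt_nonneg _), Real.sq_sqrt (by norm_num), eigenFun,
    norm_sq_smul_vMinus_add_smul_vPlus hx, div_self hc, zero_div, zero_mul, add_zero, one_mul,
    Real.cos_sq_add_sin_sq, mul_one]

theorem norm_eigenVec_zero {x : EuclideanSpace ℝ (Fin 2)} (hx : ‖x‖ = 1) {c : ℝ} (hc : c ≠ 0) :
    ‖eigenVec x 0 c c‖ = 2 := by
  have h : inner ℂ (eigenVec x 0 c c) (eigenVec x 0 c c) = ((4 : ℝ) : ℂ) := by
    rw [L2.inner_def]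
    have : ∫ t, inner ℂ (eigenVec x 0 c c t) (eigenVec x 0 c c t) ∂vol =
        ∫ _, (2 : ℂ) ∂vol := by
      refine integral_congr_ae ?_
      filter_upwards [coeFn_eigenVec x 0 c c] with t ht
      rw [ht, inner_self_eq_norm_sq_to_K, norm_eigenFun_zero hx hc]
      rw [← RCLike.ofReal_pow, Real.sq_sqrt (by norm_num)]
      simp
    rw [this, integral_const, measureReal_def, vol_univ]
    norm_num
  have h' : ‖eigenVec x 0 c c‖ ^ 2 = 4 := by
    rw [← inner_self_eq_norm_sq (𝕜 := ℂ), h]; rfl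
  nlinarith [norm_nonneg (eigenVec x 0 c c)]

theorem norm_eigenVec_sub_le {x : EuclideanSpace ℝ (Fin 2)} (hx : ‖x‖ = 1) {δ : ℝ} (hδ : 0 ≤ δ)
    {j : ℕ} (hj : 1 ≤ j) :
    ‖eigenVec x δ (eigenvalueSeq δ j) (waveNumber δ j) -
      eigenVec x 0 ((2 * j - 1) * Real.pi / 4) ((2 * j - 1) * Real.pi / 4)‖ ≤ 32 * δ := by
  have hb := Lp.norm_le_of_ae_bound (f := eigenVec x δ (eigenvalueSeq δ j) (waveNumber δ j) -
      eigenVec x 0 ((2 * j - 1) * Real.pi / 4) ((2 * j - 1) * Real.pi / 4))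
    (C := 16 * δ) (by positivity) (by
      filter_upwards [Lp.coeFn_sub (eigenVec x δ (eigenvalueSeq δ j) (waveNumber δ j))
        (eigenVec x 0 ((2 * j - 1) * Real.pi / 4) ((2 * j - 1) * Real.pi / 4)),
        coeFn_eigenVec x δ (eigenvalueSeq δ j) (waveNumber δ j),
        coeFn_eigenVec x 0 ((2 * j - 1) * Real.pi / 4) ((2 * j - 1) * Real.pi / 4),
        ae_restrict_mem measurableSet_Ioo] with t h1 h2 h3 ht
      rw [h1, Pi.sub_apply, h2, h3]
      exact norm_eigenFun_sub_le hx hδ hj ⟨ht.1.le, ht.2.le⟩)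
  refine hb.trans ?_
  have h2 : ((measureUnivNNReal vol : ℝ)) = 2 := by
    rw [measureUnivNNReal, vol_univ]; rfl
  -- Passing from the uniform bound to the L² norm costs √2, rounded up to 2.
  have h3 : (measureUnivNNReal vol : ℝ) ^ (2 : ENNReal).toReal⁻¹ ≤ 2 := by
    rw [h2]
    calc (2 : ℝ) ^ (2 : ENNReal).toReal⁻¹ ≤ (2 : ℝ) ^ (1 : ℝ) :=
          Real.rpow_le_rpow_of_exponent_le (by norm_num) (by norm_num)
      _ = 2 := Real.rpow_one 2
  have h4 : (0 : ℝ) ≤ 16 * δ := by positivity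
  calc _ ≤ 2 * (16 * δ) := mul_le_mul_of_nonneg_right h3 h4
    _ = _ := by ring

/-- The normalized `j`-th positive eigenfunction. -/
def normEigenVec (x : EuclideanSpace ℝ (Fin 2)) (δ : ℝ) (j : ℕ) : L2 :=
  ((‖eigenVec x δ (eigenvalueSeq δ j) (waveNumber δ j)‖⁻¹ : ℝ) : ℂ) •
    eigenVec x δ (eigenvalueSeq δ j) (waveNumber δ j)

theorem isNormalizedEigenvector_normEigenVec {x : EuclideanSpace ℝ (Fin 2)} (hx : ‖x‖ = 1) {δ : ℝ}
    (hδ : 0 ≤ δ) {j : ℕ} (hj : 1 ≤ j) :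
    IsNormalizedEigenvector (transverseOp x δ) (eigenvalueSeq δ j : ℂ) (normEigenVec x δ j) := by
  have hk := waveNumber_pos hδ hj
  have hkμ : waveNumber δ j ^ 2 = eigenvalueSeq δ j ^ 2 - δ ^ 2 := by
    rw [eigenvalueSeq_sq]; ring
  refine ⟨Submodule.smul_mem _ _ (eigenVec_mem_eigenspace hx hk.ne' hkμ
    ((secular_iff hδ hk).2 ⟨j, hj, rfl⟩)), ?_⟩
  rw [normEigenVec, norm_smul, Complex.norm_real, norm_inv, norm_norm]
  exact inv_mul_cancel₀ (norm_ne_zero_iff.2 (eigenVec_ne_zero _ _ _ _))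

theorem exists_smul_eq_normEigenVec {x : EuclideanSpace ℝ (Fin 2)} (hx : ‖x‖ = 1) {δ : ℝ}
    (hδ : 0 ≤ δ) {j : ℕ} (hj : 1 ≤ j) {ψ : L2}
    (hψ : IsNormalizedEigenvector (transverseOp x δ) (eigenvalueSeq δ j : ℂ) ψ) :
    ∃ c : ℂ, ‖c‖ = 1 ∧ c • ψ = normEigenVec x δ j := by
  have hk := waveNumber_pos hδ hj
  have hkμ : waveNumber δ j ^ 2 = eigenvalueSeq δ j ^ 2 - δ ^ 2 := by
    rw [eigenvalueSeq_sq]; ring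
  obtain ⟨a, ha, -⟩ := exists_smul_eigenVec hx hk.ne' hkμ hψ.1
  have hn := hψ.2
  rw [ha, norm_smul] at hn
  set N := ‖eigenVec x δ (eigenvalueSeq δ j) (waveNumber δ j)‖ with hN
  have ha0 : a ≠ 0 := fun h => by rw [h, norm_zero, zero_mul] at hn; exact zero_ne_one hn
  refine ⟨((N⁻¹ : ℝ) : ℂ) * a⁻¹, ?_, ?_⟩
  · rw [norm_mul, Complex.norm_real, norm_inv, norm_inv, hN, norm_norm, ← hN, ← mul_inv, mul_comm,
      hn, inv_one]
  · rw [ha, smul_smul, mul_assoc, inv_mul_cancel₀ ha0, mul_one, normEigenVec]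

theorem supDist_normEigenVec_le {x : EuclideanSpace ℝ (Fin 2)} (hx : ‖x‖ = 1) {δ : ℝ}
    (hδ : 0 ≤ δ) (hδ1 : δ ≤ 1 / 32) {j : ℕ} (hj : 1 ≤ j) :
    supDist (normEigenVec x δ j) (profilePlus x j) ≤ ENNReal.ofReal (48 * δ) := by
  have hj' : (1 : ℝ) ≤ j := by exact_mod_cast hj
  set c : ℝ := (2 * j - 1) * Real.pi / 4 with hc
  have hc0 : c ≠ 0 := by
    have : (0 : ℝ) < 2 * j - 1 := by linarith
    have := Real.pi_pos
    positivity
  have hdiff := norm_eigenVec_sub_le hx hδ hj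
  rw [← hc] at hdiff
  have hN := (abs_norm_sub_norm_le _ _).trans hdiff
  rw [norm_eigenVec_zero hx hc0] at hN
  set N := ‖eigenVec x δ (eigenvalueSeq δ j) (waveNumber δ j)‖ with hNdef
  -- The unperturbed norm is 2 and N differs from it by at most 32δ ≤ 1; this is where δ ≤ 1/32
  -- enters.
  have hN1 : 1 ≤ N := by
    have := (abs_le.1 hN).1
    linarith
  have hinv : N⁻¹ ≤ 1 := inv_le_one_of_one_le₀ hN1
  have hinv0 : 0 ≤ N⁻¹ := by positivity
  have hdist : |N⁻¹ - 1 / 2| ≤ 16 * δ := by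
    have : N⁻¹ - 1 / 2 = -(N - 2) * (N⁻¹ / 2) := by
      have : N ≠ 0 := by linarith
      field_simp
      ring
    rw [this, abs_mul, abs_neg, abs_of_nonneg (by positivity : 0 ≤ N⁻¹ / 2)]
    nlinarith [abs_nonneg (N - 2)]
  have hsqrt : Real.sqrt 2 ≤ 2 := by
    rw [Real.sqrt_le_left (by norm_num)]; norm_num
  rw [supDist, eLpNorm_exponent_top]
  refine eLpNormEssSup_le_of_ae_bound ?_
  filter_upwards [Lp.coeFn_smul ((N⁻¹ : ℝ) : ℂ)
      (eigenVec x δ (eigenvalueSeq δ j) (waveNumber δ j)),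
    coeFn_eigenVec x δ (eigenvalueSeq δ j) (waveNumber δ j),
    ae_restrict_mem measurableSet_Ioo] with t h1 h2 ht
  have h3 : normEigenVec x δ j t =
      ((N⁻¹ : ℝ) : ℂ) • eigenFun x δ (eigenvalueSeq δ j) (waveNumber δ j) t := by
    rw [← h2]; exact h1
  have h4 := norm_eigenFun_sub_le hx hδ hj (t := t) ⟨ht.1.le, ht.2.le⟩
  rw [← hc] at h4
  -- The first term, the change of the solution, contributes 16δ; the second, the change of
  -- normalization, contributes at most 32δ. Hence 48.
  have e : normEigenVec x δ j t - profilePlus x j t =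
      ((N⁻¹ : ℝ) : ℂ) • (eigenFun x δ (eigenvalueSeq δ j) (waveNumber δ j) t -
        eigenFun x 0 c c t) + ((N⁻¹ - 1 / 2 : ℝ) : ℂ) • eigenFun x 0 c c t := by
    rw [h3, profilePlus_eq x hj, ← hc]
    push_cast
    module
  rw [e]
  refine (norm_add_le _ _).trans ?_
  rw [norm_smul, norm_smul, Complex.norm_real, Complex.norm_real, Real.norm_eq_abs,
    Real.norm_eq_abs, norm_eigenFun_zero hx hc0, abs_of_nonneg hinv0]
  have i1 : N⁻¹ * ‖eigenFun x δ (eigenvalueSeq δ j) (waveNumber δ j) t - eigenFun x 0 c c t‖ ≤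
      1 * (16 * δ) := by gcongr
  have i2 : |N⁻¹ - 1 / 2| * Real.sqrt 2 ≤ 16 * δ * 2 := by gcongr
  linarith

end

end TransverseDirac

/-! ### The main theorem -/

theorem mainTheorem2 :
    ∃ lam : ℝ → ℕ → ℝ,
      -- (i)
      (∀ δ : ℝ, 0 ≤ δ → ∀ x : EuclideanSpace ℝ (Fin 2), ‖x‖ = 1 →
        IsSelfAdjoint (TransverseDirac.transverseOp x δ) ∧
        TransverseDirac.HasCompactResolvent (TransverseDirac.transverseOp x δ) ∧
        (∀ z : ℂ, z ∈ TransverseDirac.spectrum (TransverseDirac.transverseOp x δ) ↔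
          -z ∈ TransverseDirac.spectrum (TransverseDirac.transverseOp x δ)) ∧
        (∀ y : EuclideanSpace ℝ (Fin 2), ‖y‖ = 1 →
          TransverseDirac.spectrum (TransverseDirac.transverseOp x δ) =
            TransverseDirac.spectrum (TransverseDirac.transverseOp y δ)) ∧
        TransverseDirac.IsPosEigenvalueSeq (TransverseDirac.transverseOp x δ) (lam δ) ∧
        (∀ j : ℕ, 1 ≤ j →
          (2 * (j : ℝ) - 1) ^ 2 * (Real.pi ^ 2 / 16) ≤ lam δ j ^ 2 - δ ^ 2 ∧
          lam δ j ^ 2 - δ ^ 2 ≤ (j : ℝ) ^ 2 * (Real.pi ^ 2 / 4)) ∧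
        (∀ j : ℕ, 1 ≤ j → ∀ φ : TransverseDirac.L2,
          TransverseDirac.IsNormalizedEigenvector
            (TransverseDirac.transverseOp x δ) (lam δ j : ℂ) φ →
          TransverseDirac.IsNormalizedEigenvector
            (TransverseDirac.transverseOp x δ) (-(lam δ j : ℂ))
            (TransverseDirac.chargeConj φ))) ∧
      -- (ii)
      (∀ j : ℕ, 1 ≤ j →
        (fun δ : ℝ => lam δ j -
          ((2 * (j : ℝ) - 1) * Real.pi / 4 + 2 / ((2 * (j : ℝ) - 1) * Real.pi) * δ +
            (-16 / ((2 * (j : ℝ) - 1) ^ 3 * Real.pi ^ 3) +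
              2 / ((2 * (j : ℝ) - 1) * Real.pi)) * δ ^ 2))
          =O[nhdsWithin 0 (Set.Ici 0)] (fun δ : ℝ => δ ^ 3)) ∧
      -- (iii)
      (∀ j : ℕ, 1 ≤ j → ∃ C > (0 : ℝ), ∃ δ₀ > (0 : ℝ),
        ∀ δ : ℝ, 0 ≤ δ → δ ≤ δ₀ → ∀ x : EuclideanSpace ℝ (Fin 2), ‖x‖ = 1 →
          (∃ φ : TransverseDirac.L2,
            TransverseDirac.IsNormalizedEigenvector
              (TransverseDirac.transverseOp x δ) (lam δ j : ℂ) φ ∧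
            TransverseDirac.supDist φ (TransverseDirac.profilePlus x j) ≤
              ENNReal.ofReal (C * δ) ∧
            TransverseDirac.supDist (TransverseDirac.chargeConj φ)
              (TransverseDirac.profileMinus x j) ≤ ENNReal.ofReal (C * δ)) ∧
          (∀ ψ : TransverseDirac.L2,
            TransverseDirac.IsNormalizedEigenvector
              (TransverseDirac.transverseOp x δ) (lam δ j : ℂ) ψ →
            ∃ c : ℂ, ‖c‖ = 1 ∧
              TransverseDirac.supDist (c • ψ : TransverseDirac.L2)
                (TransverseDirac.profilePlus x j) ≤ ENNReal.ofReal (C * δ)) ∧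
          (∀ ψ : TransverseDirac.L2,
            TransverseDirac.IsNormalizedEigenvector
              (TransverseDirac.transverseOp x δ) (-(lam δ j : ℂ)) ψ →
            ∃ c : ℂ, ‖c‖ = 1 ∧
              TransverseDirac.supDist (c • ψ : TransverseDirac.L2)
                (TransverseDirac.profileMinus x j) ≤ ENNReal.ofReal (C * δ))) ∧
      -- (iv)
      (∀ δ : ℝ, 0 ≤ δ → ∀ x : EuclideanSpace ℝ (Fin 2), ‖x‖ = 1 →
        ∀ (f : (TransverseDirac.transverseOp x δ).domain) (u : ℝ → TransverseDirac.C2),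
          TransverseDirac.IsContRep (f : TransverseDirac.L2) u →
          ‖TransverseDirac.transverseOp x δ f‖ ^ 2 =
            ‖TransverseDirac.domDeriv x f‖ ^ 2 + δ ^ 2 * ‖(f : TransverseDirac.L2)‖ ^ 2 +
              δ * (‖u 1‖ ^ 2 + ‖u (-1)‖ ^ 2)) := by
  refine ⟨TransverseDirac.eigenvalueSeq, fun δ hδ x hx => ⟨?_, ?_, ?_, ?_, ?_, ?_, ?_⟩,
    fun j hj => TransverseDirac.eigenvalueSeq_asymptotics hj, fun j hj => ?_,
    fun δ _ x hx f u hu => TransverseDirac.norm_sq_transverseOp hx δ f hu⟩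
  · exact TransverseDirac.isSelfAdjoint_transverseOp hx hδ
  · exact TransverseDirac.hasCompactResolvent_transverseOp hx hδ
  · exact TransverseDirac.mem_spectrum_iff_neg_mem hx δ
  · exact fun y hy => TransverseDirac.spectrum_eq hx hy δ
  · exact TransverseDirac.isPosEigenvalueSeq hx hδ
  · exact fun j hj => TransverseDirac.eigenvalueSeq_bounds hδ hj
  · rintro j hj φ ⟨h1, h2⟩
    refine ⟨?_, by rw [TransverseDirac.norm_chargeConj, h2]⟩
    have := TransverseDirac.chargeConj_mem_eigenspace hx h1
    rwa [Complex.ofReal_neg] at this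
  · refine ⟨48, by norm_num, 1 / 32, by norm_num, fun δ hδ hδ1 x hx => ?_⟩
    have hmain := TransverseDirac.supDist_normEigenVec_le hx hδ hδ1 hj
    have hminus : TransverseDirac.supDist
        (TransverseDirac.chargeConj (TransverseDirac.normEigenVec x δ j))
        (TransverseDirac.profileMinus x j) ≤ ENNReal.ofReal (48 * δ) :=
      (TransverseDirac.supDist_chargeConj _ _).trans_le hmain
    refine ⟨⟨_, TransverseDirac.isNormalizedEigenvector_normEigenVec hx hδ hj, hmain, hminus⟩,
      fun ψ hψ => ?_, fun ψ hψ => ?_⟩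
    · obtain ⟨c, hc, e⟩ := TransverseDirac.exists_smul_eq_normEigenVec hx hδ hj hψ
      exact ⟨c, hc, by rw [e]; exact hmain⟩
    -- Charge conjugation is an involution exchanging the two eigenspaces; as it is antilinear, the
    -- phase found for the conjugated eigenfunction returns conjugated.
    · obtain ⟨h1, h2⟩ := hψ
      rw [← Complex.ofReal_neg] at h1
      have h3 := TransverseDirac.chargeConj_mem_eigenspace hx h1
      rw [neg_neg] at h3
      obtain ⟨c, hc, e⟩ := TransverseDirac.exists_smul_eq_normEigenVec hx hδ hj
        ⟨h3, by rw [TransverseDirac.norm_chargeConj, h2]⟩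
      refine ⟨starRingEnd ℂ c, by rw [RCLike.norm_conj, hc], ?_⟩
      have e2 : starRingEnd ℂ c • ψ =
          TransverseDirac.chargeConj (TransverseDirac.normEigenVec x δ j) := by
        rw [← e, map_smulₛₗ, TransverseDirac.chargeConj_chargeConj]
      rw [e2]
      exact hminus
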